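/- Let $k\ge 0$ and $n\ge 2$ be integers and put $m=kn+1$, $n'=n-1$, $m'=kn'+1$. For coprime positive integers $a,b$, let $\mathcal D_{a,b}$ be the set of lattice paths from $(0,0)$ to $(a,b)$ with unit North and East steps that stay weakly above the diagonal of slope $b/a$. The rank of a node of such a path is obtained by starting with $0$ and adding $a$ for each North step and subtracting $b$ for each East step; the terminal node, which again has rank $0$, is identified with the initial node. The sweep map $\Phi$ sends $D\in\mathcal D_{a,b}$ to the path whose steps are the steps of $D$ listed in increasing order of the ranks of their starting nodes. Let $\mathcal T_n^k$ be the set of arrays with $k+1$ rows and $n$ columns, filled bijectively with $1,2,\dots,(k+1)n$, with rows increasing from left to right and columns increasing from top to bottom, such that whenever $d$ is immediately below $a$, there are no $b,c$ with $a<b<c<d$ lying in the same column. For $D\in\mathcal D_{kn+1,n}$, the tableau $T(D)$ is the array with $k+1$ rows and $n$ columns obtained by placing $i=1,2,\dots,(k+1)n$ successively: if the $i$-th step of $D$ is North, $i$ is placed at the top of the first empty column; if it is East, $i$ is placed immediately below the smallest active entry, where an entry is active if it is at the bottom of its column and not in row $k+1$. For $T\in\mathcal T_n^k$, let $red(T)$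 be obtained by deleting the first column of $T$ and replacing each remaining entry $x$ by $x-d_x$, where $d_x$ is the number of entries of the first column smaller than $x$. Theorem (First solution to $red(T)=T'$). Let $T'\in\mathcal T_{n-1}^k$. The number of $D\in\mathcal D_{kn+1,n}$ with $red(T(D))=T'$ equals the bottom entry of the first column of $T'$. Moreover, the collection of all these $D$ is obtained by the following algorithm. 1. Let $D'$ be the path in $\mathcal D_{m',n'}$ with $T(D')=T'$; it exists and is unique. 2. Let $P'=\Phi^{-1}(D')$, the path in $\mathcal D_{m',n'}$ with $\Phi(P')=D'$; it exists and is unique. 3. Circle all nodes of $P'$ whose rank is less than $m'=k(n-1)+1$. 4. For each circled node, cut $P'$ there as $P'=AB$ and form $BA$. 5. Prepend a North step and append $k$ East steps, obtaining $N\,BA\,E^k$; this path lies in $\mathcal D_{kn+1,n}$. 6. Apply $\Phi$. The resulting paths $\Phi(N\,BA\,E^k)$ are exactly the paths $D\in\mathcal D_{kn+1,n}$ with $red(T(D))=T'$, each obtained from exactly one circled node. -/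

import Mathlib

namespace FussDyck

/-- A unit lattice step: `N` (North; its start is a South end, letter `S`) or
`E` (East; its start is a West end, letter `W`). The step word of a path `D` is thus also
the word `SW(D)`. -/
inductive Step where
  | N
  | E
deriving DecidableEq

/-- The rank, in the `m × n` rank system, of the node of the path `w` reached after its first `i`
steps: start at `0`, add `m` for each North step, subtract `n` for each East step. -/
def rank (m n : ℕ) (w : List Step) (i : ℕ) : ℤ :=
  (m : ℤ) * ((w.take i).count Step.N : ℤ) - (n : ℤ) * ((w.take i).count Step.E : ℤ)

/-- The rational Dyck paths from `(0,0)` to `(m,n)`: `n` North steps, `m` East steps, and every node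
`(a,b)` lies weakly above the diagonal of slope `n/m`, that is `b * m - a * n ≥ 0`. -/
def dyckPaths (m n : ℕ) : Set (List Step) :=
  {w | w.count Step.N = n ∧ w.count Step.E = m ∧ ∀ i ≤ w.length, 0 ≤ rank m n w i}

/-- The sweep map `Φ`: list the steps of `w` by increasing rank of their starting nodes. -/
def sweep (m n : ℕ) (w : List Step) : List Step :=
  (w.zipIdx.mergeSort (fun p q => decide (rank m n w p.2 ≤ rank m n w q.2))).map Prod.fst

/-- The family of tableaux with `k + 1` rows and `n` columns, entries `1, …, (k + 1) * n` (each used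
once), rows and columns increasing, such that whenever `d` is directly below `a`, no two distinct
entries strictly between `a` and `d` lie in the same column. -/
structure IsFussTableau (k n : ℕ) (T : Matrix (Fin (k + 1)) (Fin n) ℕ) : Prop where
  bijOn : Set.BijOn (fun p : Fin (k + 1) × Fin n => T p.1 p.2) Set.univ
    (Set.Icc 1 ((k + 1) * n))
  row_increasing : ∀ r, StrictMono (fun c => T r c)
  col_increasing : ∀ c, StrictMono (fun r => T r c)
  strip : ∀ (i : Fin k) (j : Fin n) (r s : Fin (k + 1)) (c : Fin n),
    ¬ (T i.castSucc j < T r c ∧ T r c < T s c ∧ T s c < T i.succ j)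

/-- The active entries of a partial filling with (at most) `k + 1` rows: the bottom entries of the
columns that do not yet reach row `k + 1`. A partial filling is the list of its columns from left to
right, each column being listed from bottom to top. -/
def activeEntries (k : ℕ) (F : List (List ℕ)) : List ℕ :=
  (F.filter (fun c => decide (c.length < k + 1))).filterMap List.head?

/-- One stage of the Filling Algorithm: for a North step (`S`) place `i` at the top of the first
empty column; for an East step (`W`) place `i` immediately below the smallest active entry. -/
def fillStep (k : ℕ) (F : List (List ℕ)) (i : ℕ) : Step → List (List ℕ)
  | Step.N => F ++ [[i]]
  | Step.E => F.map (fun c =>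
      if c.length < k + 1 ∧ c.head? = (activeEntries k F).min? then i :: c else c)

/-- The Filling Algorithm run on a word, its letters placing `1, 2, 3, …` in turn. -/
def fill (k : ℕ) (w : List Step) : List (List ℕ) :=
  (w.zipIdx 1).foldl (fun F p => fillStep k F p.2 p.1) []

/-- The tableau `T(D)` of a path with `n` North and `k * n + 1` East steps: the Filling Algorithm
places `1, …, m + n - 1`, so it reads all letters but the last. -/
def tableau (k n : ℕ) (D : List Step) : Matrix (Fin (k + 1)) (Fin n) ℕ :=
  fun r c => ((fill k D.dropLast).getD c []).reverse.getD r 0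

/-- `red T`: remove the first column and replace each remaining entry `x` by `x - d`, where `d` is
the number of entries of the first column that are smaller than `x`. -/
def red {k n : ℕ} (T : Matrix (Fin (k + 1)) (Fin (n + 1)) ℕ) : Matrix (Fin (k + 1)) (Fin n) ℕ :=
  fun r c => T r c.succ - (Finset.univ.filter (fun s => T s 0 < T r c.succ)).card

/-- The circled nodes of `P` (given by their positions along `P`, the endpoint being identified with
the starting point): those of rank less than `m`. -/
def circled (m n : ℕ) (P : List Step) : Set ℕ :=
  {i | i < P.length ∧ rank m n P i < (m : ℤ)}

/-- Cut `P = AB` after its first `i` steps, reverse the order of the two pieces, prepend a North step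
and append `k` East steps, obtaining `N B A E ⋯ E`. -/
def cutSwap (k : ℕ) (P : List Step) (i : ℕ) : List Step :=
  Step.N :: (P.drop i ++ P.take i ++ List.replicate k Step.E)

end FussDyck

namespace FussDyck

open List

/-! Label the letters of `Φ(P)` by the ranks of the nodes of `P` instead of by `1, 2, 3, …`; the
Filling Algorithm only compares labels, so this changes nothing but the names of the entries. For
`P` from `(0,0)` to `(kn+1, n)` the ranks are distinct, and a node of rank `r ≤ kn` must be entered
by an East step from rank `r + n`, since a North step would come from below the diagonal. Hence, up
to rank `kn`, the filling is a queue in which `r + n` is placed under `r`, and the first column is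
exactly `0, n, 2n, …, kn` (`IsRankSystem.initial_phase`, `IsRankSystem.head?_fillLabeled`). So `red`
amounts to deleting these letters (`IsRankSystem.red_tableau`).

For the path `N B A E^k`, in the rank system of `n + 1`, the deleted letters are those of the
initial `N` and of the final `E^k`. With `a = #N` and `h = k·#N - #E`, the two rank systems give
`n·h + a` and `(n+1)·h + a`, and these order the nodes of `BA` in the same way. The surviving
letters therefore spell `Φ(AB)`, and the bottom entry of the first column is `k + 1` plus the number
of nodes of `AB` ranked below the cut (`cut_swap_nodes`). Thus `red(T(Φ(N B A E^k))) = T(Φ(AB))`,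
and the bottom entry recovers the cut.

Conversely, every path for `n + 1` has the form `N B A E^k` with the cut at a circled node
(`exists_cons_swap_append`). Together with the injectivity of `T` this gives, by induction on `n`,
the bijectivity of `Φ` (`sweep_bijOn`), and then the bijection from circled nodes to the required
paths (`bijOn_circled`). The circled nodes are those of rank at most `kn`, and the bottom entry of
the first column of `T(Φ(P'))` counts precisely these (`ncard_circled`). -/

/-! ### Ranks and rational Dyck paths -/

/-- The `m × n` rank of the endpoint of the path `u`. -/
def ht (m n : ℕ) (u : List Step) : ℤ :=
  (m : ℤ) * (u.count Step.N : ℤ) - (n : ℤ) * (u.count Step.E : ℤ)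

@[simp] lemma ht_nil (m n : ℕ) : ht m n [] = 0 := by simp [ht]

@[simp] lemma ht_append (m n : ℕ) (u v : List Step) : ht m n (u ++ v) = ht m n u + ht m n v := by
  simp only [ht, count_append]; push_cast; ring

@[simp] lemma ht_N (m n : ℕ) : ht m n [Step.N] = m := by simp [ht]

@[simp] lemma ht_E (m n : ℕ) : ht m n [Step.E] = -n := by simp [ht]

lemma ht_cons (m n : ℕ) (s : Step) (u : List Step) : ht m n (s :: u) = ht m n [s] + ht m n u := by
  rw [← ht_append]; rfl

lemma ht_replicate_E (m n j : ℕ) : ht m n (replicate j Step.E) = -(n * j) := by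
  simp [ht, count_replicate]

lemma rank_eq_ht (m n : ℕ) (w : List Step) (i : ℕ) : rank m n w i = ht m n (w.take i) := rfl

lemma count_N_add_count_E (w : List Step) : w.count Step.N + w.count Step.E = w.length := by
  induction w with
  | nil => rfl
  | cons s w ih => cases s <;> simp <;> omega

lemma mem_dyckPaths_iff {m n : ℕ} {w : List Step} : w ∈ dyckPaths m n ↔
    w.count Step.N = n ∧ w.count Step.E = m ∧ ∀ u v, w = u ++ v → 0 ≤ ht m n u := by
  constructor
  · rintro ⟨h1, h2, h3⟩
    refine ⟨h1, h2, fun u v h => ?_⟩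
    have := h3 u.length (by simp [h])
    rwa [rank_eq_ht, h, take_left] at this
  · rintro ⟨h1, h2, h3⟩
    exact ⟨h1, h2, fun i _ => h3 _ _ (take_append_drop i w).symm⟩

lemma ht_dyck {m n : ℕ} {w : List Step} (hw : w ∈ dyckPaths m n) : ht m n w = 0 := by
  rw [ht, hw.1, hw.2.1]; ring

lemma length_dyck {m n : ℕ} {w : List Step} (hw : w ∈ dyckPaths m n) : w.length = n + m := by
  rw [← count_N_add_count_E, hw.1, hw.2.1]

lemma finite_dyckPaths (m n : ℕ) : (dyckPaths m n).Finite := by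
  have : Finite Step := Finite.of_injective (fun s : Step => decide (s = Step.N)) (by
    intro a b; cases a <;> cases b <;> simp)
  exact (List.finite_length_eq Step (n + m)).subset fun w hw => length_dyck hw

lemma dyck_eq_append_E {m n : ℕ} {w : List Step} (hm : 0 < m) (hw : w ∈ dyckPaths m n) :
    ∃ u, w = u ++ [Step.E] := by
  rcases eq_nil_or_concat w with rfl | ⟨u, s, rfl⟩
  · have := hw.2.1; simp at this; omega
  · rw [concat_eq_append] at *
    cases s
    · have h1 := (mem_dyckPaths_iff.1 hw).2.2 u _ rfl
      have h2 := ht_dyck hw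
      rw [ht_append, ht_N] at h2
      omega
    · exact ⟨u, rfl⟩

lemma dyck_eq_cons_N {m n : ℕ} {w : List Step} (hn : 0 < n) (hw : w ∈ dyckPaths m n) :
    ∃ u, w = Step.N :: u := by
  cases w with
  | nil => have := hw.1; simp at this; omega
  | cons s u =>
    cases s
    · exact ⟨u, rfl⟩
    · have h1 := (mem_dyckPaths_iff.1 hw).2.2 [Step.E] u rfl
      rw [ht_E] at h1; omega

/-! ### Nodes sorted by rank, and the sweep map -/

/-- The nodes of the path `w` other than its endpoint, each with the step starting there; a node is
given by the part of the path leading to it. -/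
def positions (w : List Step) : List (List Step × Step) := w.zipIdx.map fun p => (w.take p.2, p.1)

lemma mem_positions {w u : List Step} {s : Step} :
    (u, s) ∈ positions w ↔ ∃ t, w = u ++ s :: t := by
  simp only [positions, mem_map, Prod.mk.injEq, Prod.exists, mem_zipIdx_iff_getElem?]
  constructor
  · rintro ⟨a, i, h, rfl, rfl⟩
    obtain ⟨hi, rfl⟩ := List.getElem?_eq_some_iff.1 h
    exact ⟨w.drop (i + 1), by simp⟩
  · rintro ⟨t, rfl⟩
    exact ⟨s, u.length, by simp⟩

lemma length_positions (w : List Step) : (positions w).length = w.length := by simp [positions]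

lemma positions_append (w v : List Step) :
    positions (w ++ v) = positions w ++ (positions v).map fun p => (w ++ p.1, p.2) := by
  apply List.ext_getElem
  · simp [length_positions]
  · intro i h1 h2
    simp only [positions, getElem_map, getElem_zipIdx, getElem_append, length_map, length_zipIdx]
    split
    · simp [take_append_of_le_length (Nat.le_of_lt ‹_›)]
    · rename_i h
      have : i = w.length + (i - w.length) := by omega
      simp [take_append, take_of_length_le (show w.length ≤ i by omega)]

lemma positions_singleton (s : Step) : positions [s] = [([], s)] := rfl

/-- The list `L` consists of the nodes of `w`, each given by its rank and the step starting there,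
in increasing order of the ranks, which are natural numbers and pairwise distinct. -/
structure IsSortedNodes (m n : ℕ) (w : List Step) (L : List (ℕ × Step)) : Prop where
  sorted : L.Pairwise (fun p q => p.1 < q.1)
  perm : (L.map fun p => ((p.1 : ℤ), p.2)).Perm ((positions w).map fun p => (ht m n p.1, p.2))

/-- The keys of `l₂` are distinct, so the weakly sorted `l₁` (typically the output of `mergeSort`)
has no ties to break. -/
lemma eq_of_perm_of_sorted {α β : Type*} [LinearOrder α] {l₁ l₂ : List (α × β)}
    (h : l₁.Perm l₂) (h1 : l₁.Pairwise (fun p q => p.1 ≤ q.1))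
    (h2 : l₂.Pairwise (fun p q => p.1 < q.1)) : l₁ = l₂ := by
  have hinj : ∀ a ∈ l₂, ∀ b ∈ l₂, a.1 = b.1 → a = b := by
    intro a ha b hb hab
    by_contra hne
    have h3 : l₂.Pairwise (fun p q => p.1 ≠ q.1) := h2.imp fun h => ne_of_lt h
    have : Std.Symm (fun p q : α × β => p.1 ≠ q.1) := ⟨fun _ _ h => Ne.symm h⟩
    exact h3.forall ha hb hne hab
  refine List.Perm.eq_of_pairwise (le := fun p q : α × β => p.1 ≤ q.1) ?_ h1
    (h2.imp fun h => le_of_lt h) h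
  intro a b ha hb hab hba
  exact hinj a (h.subset ha) b hb (le_antisymm hab hba)

lemma exists_sorted_perm {α β : Type*} [LinearOrder β] (f : α → β) (l : List α)
    (h : l.Pairwise fun p q => f p ≠ f q) : ∃ M : List α, M.Perm l ∧
      M.Pairwise fun p q => f p < f q := by
  refine ⟨l.mergeSort (fun p q => decide (f p ≤ f q)), mergeSort_perm _ _, ?_⟩
  have h1 := pairwise_mergeSort (le := fun p q => decide (f p ≤ f q))
    (by intro a b c; simpa using le_trans) (by intro a b; simpa using le_total _ _) l
  have h2 := (mergeSort_perm l (fun p q => decide (f p ≤ f q))).symm.pairwise h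
    (fun h => h.symm)
  exact (h1.and h2).imp fun ⟨h, h'⟩ => lt_of_le_of_ne (by simpa using h) h'

lemma IsSortedNodes.sweep_eq {m n : ℕ} {w : List Step} {L : List (ℕ × Step)}
    (h : IsSortedNodes m n w L) : sweep m n w = L.map Prod.snd := by
  have key : ((w.zipIdx.mergeSort
      (fun p q => decide (rank m n w p.2 ≤ rank m n w q.2))).map
        fun p => (rank m n w p.2, p.1)) = L.map fun p => ((p.1 : ℤ), p.2) := by
    apply eq_of_perm_of_sorted
    · refine ((mergeSort_perm _ _).map _).trans ?_
      refine Perm.trans ?_ h.perm.symm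
      simp [positions, Function.comp_def, rank_eq_ht]
    · rw [pairwise_map]
      have h1 := pairwise_mergeSort (le := fun p q : Step × ℕ =>
        decide (rank m n w p.2 ≤ rank m n w q.2))
        (by intro a b c; simpa using le_trans) (by intro a b; simpa using le_total _ _) w.zipIdx
      exact h1.imp (by simp)
    · rw [pairwise_map]
      exact h.sorted.imp (by simp)
  have := congrArg (List.map Prod.snd) key
  simpa [sweep, Function.comp_def] using this

lemma IsSortedNodes.mem_iff {m n : ℕ} {w : List Step} {L : List (ℕ × Step)}
    (h : IsSortedNodes m n w L) {r : ℕ} {s : Step} :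
    (r, s) ∈ L ↔ ∃ u t, w = u ++ s :: t ∧ ht m n u = r := by
  have h1 : (r, s) ∈ L ↔ ((r : ℤ), s) ∈ (L.map fun p => ((p.1 : ℤ), p.2)) := by
    simp
  rw [h1, h.perm.mem_iff]
  simp only [mem_map, Prod.exists, Prod.mk.injEq, mem_positions]
  constructor
  · rintro ⟨u, s, ⟨t, ht⟩, h, rfl⟩; exact ⟨u, t, ht, h⟩
  · rintro ⟨u, t, ht, h⟩; exact ⟨u, s, ⟨t, ht⟩, h, rfl⟩

/-- Supplies the factor `v` between two nodes for `ht_ne_zero_of_factor`; since the endpoint is not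
listed, `t` is nonempty and `v` is proper. -/
lemma positions_pairwise (w : List Step) : (positions w).Pairwise fun p q =>
    ∃ v t, v ≠ [] ∧ t ≠ [] ∧ q.1 = p.1 ++ v ∧ w = p.1 ++ v ++ t := by
  rw [pairwise_iff_getElem]
  intro i j hi hj hij
  rw [length_positions] at hi hj
  refine ⟨(w.drop i).take (j - i), w.drop j, ?_, ?_, ?_, ?_⟩
  · simp; omega
  · simp; omega
  · simp only [positions, getElem_map, getElem_zipIdx]
    simp only [Nat.zero_add]
    rw [← take_add]; congr 1; omega
  · simp only [positions, getElem_map, getElem_zipIdx, Nat.zero_add]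
    rw [← take_add, show i + (j - i) = j by omega, take_append_drop]

/-- A proper nonempty factor of a word with `n` North and `k * n + 1` East steps does not have
height zero. -/
lemma ht_ne_zero_of_factor {k n : ℕ} {w u v t : List Step} (hN : w.count Step.N = n)
    (hE : w.count Step.E = k * n + 1) (h : w = u ++ v ++ t) (hv : v ≠ []) (ht' : u ++ t ≠ []) :
    ht (k * n + 1) n v ≠ 0 := by
  intro h0
  have hN' : u.count Step.N + v.count Step.N + t.count Step.N = n := by
    rw [← hN, h]; simp [count_append, add_assoc]
  have hE' : u.count Step.E + v.count Step.E + t.count Step.E = k * n + 1 := by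
    rw [← hE, h]; simp [count_append, add_assoc]
  have hvl : 0 < v.length := length_pos_iff.2 hv
  have htl : 0 < (u ++ t).length := length_pos_iff.2 ht'
  rw [length_append] at htl
  have c1 := count_N_add_count_E u
  have c2 := count_N_add_count_E v
  have c3 := count_N_add_count_E t
  rw [ht] at h0
  have h1 : (k * n + 1) * v.count Step.N = n * v.count Step.E := by
    zify; push_cast at h0; linarith
  -- By coprimality `v` contains none or all of the North steps; accordingly it is empty or the
  -- whole word.
  have hdvd : n ∣ v.count Step.N := by
    have h2 : n ∣ (k * n + 1) * v.count Step.N := ⟨_, h1⟩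
    have h3 : Nat.Coprime n (k * n + 1) := by simp
    exact h3.dvd_of_dvd_mul_left h2
  obtain ⟨q, hq⟩ := hdvd
  have hle : v.count Step.N ≤ n := by omega
  rcases Nat.eq_zero_or_pos n with rfl | hn
  · omega
  rcases q with _ | q
  · have : n * v.count Step.E = 0 := by rw [← h1, hq]; simp
    rcases Nat.mul_eq_zero.1 this with h | h <;> omega
  · have hv' : v.count Step.N = n := by nlinarith
    rw [hv', mul_comm] at h1
    have := Nat.eq_of_mul_eq_mul_left hn h1
    omega

lemma exists_isSortedNodes {k n : ℕ} {w : List Step} (hw : w ∈ dyckPaths (k * n + 1) n) :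
    ∃ L, IsSortedNodes (k * n + 1) n w L := by
  obtain ⟨M, hM, hs⟩ := exists_sorted_perm (fun p : List Step × Step => ht (k * n + 1) n p.1)
    (positions w) (by
      refine (positions_pairwise w).imp ?_
      rintro p q ⟨v, t, hv, ht, hq, hw'⟩
      have := ht_ne_zero_of_factor hw.1 hw.2.1 hw' hv (by simp [ht])
      rw [hq, ht_append]
      omega)
  have hpos : ∀ p ∈ M, 0 ≤ ht (k * n + 1) n p.1 := by
    intro p hp
    obtain ⟨t, ht⟩ := mem_positions.1 (hM.subset hp)
    exact (mem_dyckPaths_iff.1 hw).2.2 _ _ ht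
  refine ⟨M.map fun p => ((ht (k * n + 1) n p.1).toNat, p.2), ?_, ?_⟩
  · rw [pairwise_map]
    refine hs.imp_of_mem ?_
    intro a b ha hb hab
    have := hpos a ha
    have := hpos b hb
    simp only at hab ⊢
    omega
  · refine Perm.trans ?_ (hM.map _)
    rw [map_map]
    refine Perm.of_eq (map_congr_left ?_)
    intro p hp
    simp [Int.toNat_of_nonneg (hpos p hp)]

lemma IsSortedNodes.zero_mem {k n : ℕ} {w : List Step} {L : List (ℕ × Step)} (hn : 0 < n)
    (hw : w ∈ dyckPaths (k * n + 1) n) (h : IsSortedNodes (k * n + 1) n w L) :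
    (0, Step.N) ∈ L := by
  obtain ⟨u, rfl⟩ := dyck_eq_cons_N hn hw
  exact h.mem_iff.2 ⟨[], u, rfl, by simp⟩

/-- The East step from rank `r` ends at rank `r - n`; if it is the last step, it ends at the
endpoint, which is identified with the start. -/
lemma IsSortedNodes.sub_mem {k n : ℕ} {w : List Step} {L : List (ℕ × Step)}
    (hw : w ∈ dyckPaths (k * n + 1) n) (h : IsSortedNodes (k * n + 1) n w L) {r : ℕ}
    (hr : (r, Step.E) ∈ L) : n ≤ r ∧ ∃ s, (r - n, s) ∈ L := by
  obtain ⟨u, t, rfl, hu⟩ := h.mem_iff.1 hr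
  have h1 := (mem_dyckPaths_iff.1 hw).2.2 (u ++ [Step.E]) t (by simp)
  rw [ht_append, ht_E] at h1
  have hle : n ≤ r := by omega
  refine ⟨hle, ?_⟩
  rcases t with _ | ⟨s, t⟩
  · have h2 := ht_dyck hw
    rw [ht_append, ht_E] at h2
    have h3 : r - n = 0 := by omega
    rw [h3]
    obtain ⟨s, t, hst⟩ : ∃ s t, u ++ [Step.E] = s :: t := by
      cases u <;> simp
    exact ⟨s, h.mem_iff.2 ⟨[], t, by simpa using hst, by simp⟩⟩
  · exact ⟨s, h.mem_iff.2 ⟨u ++ [Step.E], t, by simp, by rw [ht_append, ht_E]; omega⟩⟩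

/-- A North step into rank `r ≤ kn` would start at a negative rank, so the node is entered by an
East step from `r + n`. The starting node counts as entered by the last step. This is what governs
the first column. -/
lemma IsSortedNodes.add_mem {k n : ℕ} {w : List Step} {L : List (ℕ × Step)}
    (hw : w ∈ dyckPaths (k * n + 1) n) (h : IsSortedNodes (k * n + 1) n w L) {r : ℕ} {s : Step}
    (hr : (r, s) ∈ L) (hle : r ≤ k * n) : (r + n, Step.E) ∈ L := by
  obtain ⟨u, t, hw', hu⟩ := h.mem_iff.1 hr
  rcases eq_nil_or_concat u with rfl | ⟨u, x, rfl⟩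
  · obtain ⟨v, rfl⟩ := dyck_eq_append_E (Nat.succ_pos _) hw
    have h2 := ht_dyck hw
    rw [ht_append, ht_E] at h2
    rw [ht_nil] at hu
    exact h.mem_iff.2 ⟨v, [], rfl, by omega⟩
  · rw [concat_eq_append] at hu hw'
    rw [ht_append] at hu
    cases x
    · have h1 := (mem_dyckPaths_iff.1 hw).2.2 u _ (by rw [hw', append_assoc])
      rw [ht_N] at hu
      push_cast at hu
      zify at hle
      omega
    · rw [ht_E] at hu
      exact h.mem_iff.2 ⟨u, s :: t, by simpa using hw', by push_cast; omega⟩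

/-! ### The Filling Algorithm with arbitrary labels -/

/-- The Filling Algorithm with arbitrary labels in place of `1, 2, 3, …`. -/
def fillLabeled (k : ℕ) (L : List (ℕ × Step)) : List (List ℕ) :=
  L.foldl (fun F p => fillStep k F p.1 p.2) []

@[simp] lemma fillLabeled_nil (k : ℕ) : fillLabeled k [] = [] := rfl

lemma fillLabeled_concat (k : ℕ) (L : List (ℕ × Step)) (p : ℕ × Step) :
    fillLabeled k (L ++ [p]) = fillStep k (fillLabeled k L) p.1 p.2 := by
  simp [fillLabeled]

lemma fill_eq_fillLabeled (k : ℕ) (w : List Step) :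
    fill k w = fillLabeled k ((w.zipIdx 1).map Prod.swap) := by
  simp [fill, fillLabeled, foldl_map]

lemma min?_map_of_monotone {f : ℕ → ℕ} (hf : Monotone f) (l : List ℕ) :
    (l.map f).min? = l.min?.map f := by
  induction l with
  | nil => rfl
  | cons x l ih =>
    rw [map_cons, min?_cons, min?_cons, ih]
    cases l.min? <;> simp [hf.map_min]

lemma mem_activeEntries {k : ℕ} {F : List (List ℕ)} {x : ℕ} :
    x ∈ activeEntries k F ↔ ∃ c ∈ F, c.length < k + 1 ∧ c.head? = some x := by
  simp [activeEntries, and_assoc]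

lemma activeEntries_map (k : ℕ) (f : ℕ → ℕ) (F : List (List ℕ)) :
    activeEntries k (F.map (List.map f)) = (activeEntries k F).map f := by
  simp [activeEntries, filter_map, filterMap_map, map_filterMap, Function.comp_def]

/-- The algorithm only looks for a smallest entry. Injectivity is required only on the labels
present because `pos L` is not injective elsewhere. -/
lemma fillStep_map {k : ℕ} {f : ℕ → ℕ} (hf : Monotone f) {A : Set ℕ} (hA : Set.InjOn f A)
    {F : List (List ℕ)} (hF : ∀ c ∈ F, ∀ x ∈ c, x ∈ A) (i : ℕ) (s : Step) :
    fillStep k (F.map (List.map f)) (f i) s = (fillStep k F i s).map (List.map f) := by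
  cases s with
  | N => simp [fillStep]
  | E =>
    simp only [fillStep, map_map]
    refine map_congr_left fun c hc => ?_
    have key : (c.map f).head? = (activeEntries k (F.map (List.map f))).min? ↔
        c.head? = (activeEntries k F).min? := by
      rw [activeEntries_map, min?_map_of_monotone hf, head?_map]
      constructor
      · intro h
        rcases h1 : c.head? with _ | x <;> rcases h2 : (activeEntries k F).min? with _ | y
        · rfl
        · simp [h1, h2] at h
        · simp [h1, h2] at h
        · rw [h1, h2] at h
          simp only [Option.map_some, Option.some.injEq] at h
          have hx : x ∈ A := hF c hc x (mem_of_head? h1)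
          have hy : y ∈ A := by
            obtain ⟨d, hd, -, hy⟩ := mem_activeEntries.1 (min?_mem h2)
            exact hF d hd y (mem_of_head? hy)
          rw [hA hx hy h]
      · intro h; rw [h]
    simp only [Function.comp_apply, length_map, key]
    split <;> simp

/-- All columns are nonempty and no two of them have the same bottom entry. -/
structure GoodFilling (F : List (List ℕ)) : Prop where
  ne_nil : ∀ c ∈ F, c ≠ []
  heads : F.Pairwise fun c d => c.head? ≠ d.head?

lemma GoodFilling.fillStep {F : List (List ℕ)} (hF : GoodFilling F) (k : ℕ) {i : ℕ}
    (hi : ∀ c ∈ F, ∀ x ∈ c, x < i) (s : Step) : GoodFilling (fillStep k F i s) := by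
  have hne : ∀ c ∈ F, c.head? ≠ some i := fun c hc h =>
    lt_irrefl _ (hi c hc i (mem_of_head? h))
  cases s with
  | N =>
    refine ⟨?_, ?_⟩
    · simp only [FussDyck.fillStep, mem_append, mem_singleton]
      rintro c (hc | rfl)
      · exact hF.ne_nil c hc
      · simp
    · simp only [FussDyck.fillStep, pairwise_append, hF.heads, pairwise_singleton, true_and,
        mem_singleton]
      rintro c hc d rfl
      simpa using hne c hc
  | E =>
    refine ⟨?_, ?_⟩
    · simp only [FussDyck.fillStep, mem_map]
      rintro _ ⟨c, hc, rfl⟩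
      split
      · simp
      · exact hF.ne_nil c hc
    · simp only [FussDyck.fillStep, pairwise_map]
      refine hF.heads.imp_of_mem ?_
      intro c d hc hd hcd
      split <;> split
      · rename_i h1 h2
        exact absurd (h1.2.trans h2.2.symm) hcd
      · simpa using (hne d hd).symm
      · simpa using hne c hc
      · exact hcd

lemma mem_of_mem_fillStep {k : ℕ} {F : List (List ℕ)} {i : ℕ} {s : Step} {c : List ℕ} {x : ℕ}
    (hc : c ∈ fillStep k F i s) (hx : x ∈ c) : x = i ∨ ∃ d ∈ F, x ∈ d := by
  cases s with
  | N =>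
    simp only [fillStep, mem_append, mem_singleton] at hc
    rcases hc with hc | rfl
    · exact Or.inr ⟨c, hc, hx⟩
    · exact Or.inl (by simpa using hx)
  | E =>
    simp only [fillStep, mem_map] at hc
    obtain ⟨d, hd, rfl⟩ := hc
    split at hx
    · rcases mem_cons.1 hx with h | h
      · exact Or.inl h
      · exact Or.inr ⟨d, hd, h⟩
    · exact Or.inr ⟨d, hd, hx⟩

lemma mem_of_mem_fillLabeled {k : ℕ} {L : List (ℕ × Step)} {c : List ℕ} {x : ℕ}
    (hc : c ∈ fillLabeled k L) (hx : x ∈ c) : ∃ s, (x, s) ∈ L := by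
  induction L using List.reverseRecOn generalizing c with
  | nil => simp at hc
  | append_singleton L p ih =>
    rw [fillLabeled_concat] at hc
    rcases mem_of_mem_fillStep hc hx with rfl | ⟨d, hd, h⟩
    · exact ⟨p.2, by simp⟩
    · obtain ⟨s, hs⟩ := ih hd h
      exact ⟨s, by simp [hs]⟩

lemma goodFilling_fillLabeled (k : ℕ) {L : List (ℕ × Step)}
    (hL : L.Pairwise fun p q => p.1 < q.1) : GoodFilling (fillLabeled k L) := by
  induction L using List.reverseRecOn with
  | nil => exact ⟨by simp, by simp⟩
  | append_singleton L p ih =>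
    rw [pairwise_append] at hL
    rw [fillLabeled_concat]
    refine (ih hL.1).fillStep k ?_ _
    intro c hc x hx
    obtain ⟨s, hs⟩ := mem_of_mem_fillLabeled hc hx
    exact hL.2.2 _ hs p (by simp)

/-- If the first column is not served, it is full or its bottom is not the smallest active entry, so
ignoring it leaves the minimum unchanged. Distinct bottoms ensure that at most one column is served.
-/
lemma fillStep_cons_E {k : ℕ} {c : List ℕ} {F : List (List ℕ)} (h : GoodFilling (c :: F)) (i : ℕ) :
    fillStep k (c :: F) i Step.E =
      if c.length < k + 1 ∧ c.head? = (activeEntries k (c :: F)).min? then (i :: c) :: F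
      else c :: fillStep k F i Step.E := by
  have hh := pairwise_cons.1 h.heads
  split
  · rename_i hc
    simp only [fillStep, map_cons, if_pos hc]
    congr 1
    conv_rhs => rw [← map_id F]
    refine map_congr_left fun d hd => ?_
    rw [if_neg]
    · rfl
    · rintro ⟨-, h2⟩
      exact hh.1 d hd (hc.2.trans h2.symm)
  · rename_i hc
    simp only [fillStep, map_cons, if_neg hc]
    congr 1
    have key : ∀ d ∈ F, d.length < k + 1 →
        (d.head? = (activeEntries k (c :: F)).min? ↔ d.head? = (activeEntries k F).min?) := by
      intro d hd hdl
      by_cases hl : c.length < k + 1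
      · obtain ⟨x, hx⟩ : ∃ x, c.head? = some x := by
          rcases c with _ | ⟨x, c⟩
          · exact absurd rfl (h.ne_nil [] (by simp))
          · exact ⟨x, rfl⟩
        have hne : c.head? ≠ (activeEntries k (c :: F)).min? := fun h' => hc ⟨hl, h'⟩
        have ha : activeEntries k (c :: F) = x :: activeEntries k F := by
          simp only [activeEntries, filter_cons, hl, decide_true, if_true, filterMap_cons, hx]
        rw [ha, min?_cons] at hne ⊢
        obtain ⟨y, hy⟩ : ∃ y, (activeEntries k F).min? = some y := by
          rcases hm : (activeEntries k F).min? with _ | y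
          · simp [hm, hx] at hne
          · exact ⟨y, rfl⟩
        rw [hy, hx] at hne
        rw [hy]
        simp only [Option.elim_some, ne_eq, Option.some.injEq] at hne ⊢
        rw [min_eq_right (by omega)]
      · simp only [activeEntries, filter_cons, hl, decide_false]
        simp
    refine map_congr_left fun d hd => ?_
    by_cases hdl : d.length < k + 1
    · simp only [key d hd hdl]
    · rw [if_neg (fun h => hdl h.1), if_neg (fun h => hdl h.1)]

/-- If the labels in the first column are those which satisfy `Z`, then the other columns are filled
as if these labels were absent. -/
lemma tail_fillLabeled (k : ℕ) (Z : ℕ → Prop) [DecidablePred Z] {L : List (ℕ × Step)}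
    (hL : L.Pairwise fun p q => p.1 < q.1)
    (hZ : ∀ pre, pre <+: L → pre ≠ [] → (fillLabeled k pre).head? =
      some ((pre.map Prod.fst).filter (fun r => decide (Z r))).reverse) :
    (fillLabeled k L).tail = fillLabeled k (L.filter fun p => decide (¬ Z p.1)) := by
  induction L using List.reverseRecOn with
  | nil => rfl
  | append_singleton L p ih =>
    have ih := ih (pairwise_append.1 hL).1
      (fun pre h h' => hZ pre (h.trans (prefix_append _ _)) h')
    have h1 := hZ _ (prefix_refl _) (by simp)
    have hg := goodFilling_fillLabeled k (pairwise_append.1 hL).1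
    rw [fillLabeled_concat] at h1 ⊢
    rw [filter_append]
    obtain ⟨r, s⟩ := p
    rcases eq_or_ne L [] with rfl | hne
    · cases s
      · simp only [fillLabeled_nil, fillStep, nil_append, map_cons, map_nil, head?_cons,
          Option.some.injEq, filter_cons, filter_nil] at h1 ⊢
        by_cases hr : Z r
        · simp [hr]
        · simp [hr] at h1
      · simp [fillStep] at h1
    · have h0 := hZ L (prefix_append _ _) hne
      obtain ⟨F, hF⟩ : ∃ F, fillLabeled k L =
          ((L.map Prod.fst).filter (fun r => decide (Z r))).reverse :: F := by
        rcases h : fillLabeled k L with _ | ⟨c, F⟩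
        · simp [h] at h0
        · rw [h] at h0; simp only [head?_cons, Option.some.injEq] at h0
          exact ⟨F, by rw [h0]⟩
      rw [hF] at h1 hg ih ⊢
      rw [tail_cons] at ih
      set c := ((L.map Prod.fst).filter (fun r => decide (Z r))).reverse with hcdef
      -- `hZ` dictates whether the first column grows: if `Z r`, the letter is absorbed there and
      -- the tail is untouched; otherwise the letter acts on the tail alone.
      by_cases hr : Z r
      · have h2 : ((map Prod.fst (L ++ [(r, s)])).filter (fun r => decide (Z r))).reverse
            = r :: c := by
          simp [hcdef, hr]
        rw [h2] at h1
        have h3 : filter (fun p => decide ¬Z p.1) [(r, s)] = [] := by simp [hr]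
        rw [h3, append_nil, ← ih]
        cases s
        · simp [fillStep] at h1
        · rw [fillStep_cons_E hg] at h1 ⊢
          split at h1
          · rename_i h; rw [if_pos h]; rfl
          · simp at h1
      · have h2 : ((map Prod.fst (L ++ [(r, s)])).filter (fun r => decide (Z r))).reverse = c := by
          simp [hcdef, hr]
        rw [h2] at h1
        have h3 : filter (fun p => decide ¬Z p.1) [(r, s)] = [(r, s)] := by simp [hr]
        rw [h3, fillLabeled_concat, ← ih]
        cases s
        · simp [fillStep]
        · rw [fillStep_cons_E hg] at h1 ⊢
          split at h1
          · simp at h1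
          · rename_i h; rw [if_neg h]; rfl

/-! ### Relabelling ranks by their positions -/

/-- The number of labels in `L` up to `r`. -/
def pos (L : List (ℕ × Step)) (r : ℕ) : ℕ := L.countP fun p => decide (p.1 ≤ r)

lemma pos_mono (L : List (ℕ × Step)) : Monotone (pos L) := fun a b hab =>
  countP_mono_left fun p _ h => by simp only [decide_eq_true_eq] at h ⊢; omega

lemma pos_lt {L : List (ℕ × Step)} {a b : ℕ} {s : Step} (hab : a < b) (hb : (b, s) ∈ L) :
    pos L a < pos L b := by
  induction L with
  | nil => simp at hb
  | cons p L ih =>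
    simp only [pos, countP_cons] at ih ⊢
    rcases mem_cons.1 hb with rfl | h
    · have := pos_mono L hab.le
      simp only [pos] at this
      simp only [if_neg (show ¬ decide (b ≤ a) = true by simpa using hab), le_refl, decide_true,
        if_true]
      omega
    · have := ih h
      by_cases h1 : p.1 ≤ a
      · simp [h1, h1.trans hab.le, this]
      · simp only [h1]; simp; omega

lemma pos_injOn (L : List (ℕ × Step)) : Set.InjOn (pos L) {x | ∃ s, (x, s) ∈ L} := by
  rintro a ⟨s, ha⟩ b ⟨t, hb⟩ h
  rcases lt_trichotomy a b with h1 | h1 | h1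
  · exact absurd h (pos_lt h1 hb).ne
  · exact h1
  · exact absurd h (pos_lt h1 ha).ne'

lemma zipIdx_swap_eq {L : List (ℕ × Step)} (hL : L.Pairwise fun p q => p.1 < q.1) :
    ((L.map Prod.snd).zipIdx 1).map Prod.swap = L.map fun p => (pos L p.1, p.2) := by
  induction L using List.reverseRecOn with
  | nil => rfl
  | append_singleton L p ih =>
    rw [pairwise_append] at hL
    rw [map_append, zipIdx_append, map_append, ih hL.1, map_append]
    have h1 : ∀ q ∈ L, q.1 < p.1 := fun q hq => hL.2.2 q hq p (by simp)
    congr 1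
    · refine map_congr_left fun q hq => ?_
      have := h1 q hq
      simp [pos, countP_append, this]
    · have : countP (fun q => decide (q.1 ≤ p.1)) L = L.length := by
        rw [countP_eq_length]
        intro q hq
        simpa using (h1 q hq).le
      simp [pos, countP_append, this, add_comm]

lemma fill_map_snd (k : ℕ) {L : List (ℕ × Step)} (hL : L.Pairwise fun p q => p.1 < q.1) :
    fill k (L.map Prod.snd) = (fillLabeled k L).map (List.map (pos L)) := by
  rw [fill_eq_fillLabeled, zipIdx_swap_eq hL]
  -- The induction runs over prefixes `Q` so that the relabelling `pos L` stays fixed.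
  suffices h : ∀ Q, Q <+: L → fillLabeled k (Q.map fun p => (pos L p.1, p.2)) =
      (fillLabeled k Q).map (List.map (pos L)) from h L (prefix_refl _)
  intro Q
  induction Q using List.reverseRecOn with
  | nil => intro; rfl
  | append_singleton Q p ih =>
    intro hQ
    rw [map_append, map_singleton, fillLabeled_concat, fillLabeled_concat,
      ih ((prefix_append _ _).trans hQ)]
    refine fillStep_map (pos_mono L) (pos_injOn L) ?_ _ _
    intro c hc x hx
    obtain ⟨s, hs⟩ := mem_of_mem_fillLabeled hc hx
    exact ⟨s, ((prefix_append _ _).trans hQ).subset hs⟩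

/-! ### The first column of the filling by ranks -/

/-- The properties of the nodes of a path in `dyckPaths (k * n + 1) n` with `n > 0`, listed by rank,
on which the position of the first column of the filling depends. -/
structure IsRankSystem (k n : ℕ) (L : List (ℕ × Step)) : Prop where
  sorted : L.Pairwise (fun p q => p.1 < q.1)
  n_pos : 0 < n
  zero_mem : (0, Step.N) ∈ L
  sub_mem : ∀ r, (r, Step.E) ∈ L → n ≤ r ∧ ∃ s, (r - n, s) ∈ L
  add_mem : ∀ r s, (r, s) ∈ L → r ≤ k * n → (r + n, Step.E) ∈ L

lemma IsSortedNodes.isRankSystem {k n : ℕ} {w : List Step} {L : List (ℕ × Step)} (hn : 0 < n)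
    (hw : w ∈ dyckPaths (k * n + 1) n) (h : IsSortedNodes (k * n + 1) n w L) :
    IsRankSystem k n L where
  sorted := h.sorted
  n_pos := hn
  zero_mem := h.zero_mem hn hw
  sub_mem _ hr := h.sub_mem hw hr
  add_mem _ _ hr hle := h.add_mem hw hr hle

lemma IsRankSystem.mul_mem {k n : ℕ} {L : List (ℕ × Step)} (h : IsRankSystem k n L) {j : ℕ}
    (hj : j ≤ k + 1) : ∃ s, (j * n, s) ∈ L := by
  induction j with
  | zero => exact ⟨_, by simpa using h.zero_mem⟩
  | succ j ih =>
    obtain ⟨s, hs⟩ := ih (by omega)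
    exact ⟨_, by rw [Nat.succ_mul]; exact h.add_mem _ _ hs (Nat.mul_le_mul_right n (by omega))⟩

lemma filter_dvd_eq {k n : ℕ} {l : List ℕ} (hl : l.Pairwise (· < ·)) (hn : 0 < n)
    (h : ∀ j ≤ k, j * n ∈ l) :
    l.filter (fun r => decide (n ∣ r ∧ r ≤ k * n)) = (range (k + 1)).map (· * n) := by
  have h1 : ((range (k + 1)).map (· * n)).Pairwise (· < ·) := by
    rw [pairwise_map]
    exact pairwise_lt_range.imp fun h => Nat.mul_lt_mul_of_pos_right h hn
  have h2 := hl.filter (fun r => decide (n ∣ r ∧ r ≤ k * n))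
  refine Perm.eq_of_pairwise (le := (· < ·)) (fun a b _ _ hab hba => absurd hab hba.asymm) h2 h1 ?_
  rw [perm_ext_iff_of_nodup (h2.imp ne_of_lt) (h1.imp ne_of_lt)]
  intro a
  simp only [mem_filter, decide_eq_true_eq, mem_map, mem_range]
  constructor
  · rintro ⟨-, ⟨j, rfl⟩, hj⟩
    refine ⟨j, ?_, mul_comm _ _⟩
    rw [mul_comm] at hj
    have := Nat.le_of_mul_le_mul_right hj hn
    omega
  · rintro ⟨j, hj, rfl⟩
    exact ⟨h j (by omega), Dvd.intro_left _ rfl, Nat.mul_le_mul_right n (by omega)⟩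

lemma mem_of_lt_of_prefix {L pre : List (ℕ × Step)} (hL : L.Pairwise (fun p q => p.1 < q.1))
    {p q : ℕ × Step} (h : pre ++ [p] <+: L) (hq : q ∈ L) (hlt : q.1 < p.1) : q ∈ pre := by
  obtain ⟨suf, rfl⟩ := h
  rw [append_assoc, pairwise_append] at hL
  simp only [append_assoc, cons_append, nil_append, mem_append, mem_cons] at hq
  rcases hq with h | rfl | h
  · exact h
  · omega
  · have := (pairwise_cons.1 hL.2.1).1 q h
    omega

lemma eq_of_fst_eq {L : List (ℕ × Step)} (hL : L.Pairwise (fun p q => p.1 < q.1))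
    {p q : ℕ × Step} (hp : p ∈ L) (hq : q ∈ L) (h : p.1 = q.1) : p = q := by
  by_contra hne
  have : Std.Symm (fun p q : ℕ × Step => p.1 ≠ q.1) := ⟨fun _ _ h => Ne.symm h⟩
  exact (hL.imp (S := fun p q : ℕ × Step => p.1 ≠ q.1) (fun h => ne_of_lt h)).forall hp hq hne h

lemma lt_of_prefix {L pre : List (ℕ × Step)} (hL : L.Pairwise (fun p q => p.1 < q.1))
    {p q : ℕ × Step} (h : pre ++ [p] <+: L) (hq : q ∈ pre) : q.1 < p.1 :=
  (pairwise_append.1 (hL.sublist h.sublist)).2.2 q hq p (by simp)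

lemma IsRankSystem.eq_zero_of_prefix {k n : ℕ} {L : List (ℕ × Step)} (h : IsRankSystem k n L)
    {p : ℕ × Step} (hp : [p] <+: L) : p = (0, Step.N) := by
  have hpL : p ∈ L := hp.subset (by simp)
  rcases Nat.eq_zero_or_pos p.1 with h0 | h0
  · exact eq_of_fst_eq h.sorted hpL h.zero_mem h0
  · have := mem_of_lt_of_prefix (pre := []) h.sorted hp h.zero_mem h0
    simp at this

/-- Until the rank `k * n` is passed, every column is served whenever the rank has increased
by `n`. -/
lemma IsRankSystem.initial_phase {k n : ℕ} {L : List (ℕ × Step)} (h : IsRankSystem k n L)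
    {pre : List (ℕ × Step)} (hpre : pre <+: L) (hne : pre ≠ []) (hle : ∀ q ∈ pre, q.1 ≤ k * n) :
    (fillLabeled k pre).head? = some ((pre.map Prod.fst).filter
      (fun r => decide (n ∣ r ∧ r ≤ k * n))).reverse ∧
    (∀ c ∈ fillLabeled k pre, ∃ r s, c.head? = some r ∧ (r, s) ∈ pre ∧
      (∀ q ∈ pre, q.1 < r + n) ∧ c.length * n ≤ r + n) ∧
    (∀ r s, (r, s) ∈ pre → (∀ q ∈ pre, q.1 < r + n) →
      ∃ c ∈ fillLabeled k pre, c.head? = some r) := by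
  have hn := h.n_pos
  induction pre using List.reverseRecOn with
  | nil => simp at hne
  | append_singleton pre p ih =>
    rcases eq_or_ne pre [] with rfl | hne'
    · obtain rfl := h.eq_zero_of_prefix hpre
      simpa [fillLabeled, fillStep] using hn
    obtain ⟨hfst, hcol, hserv⟩ := ih ((prefix_append _ _).trans hpre) hne'
      (fun q hq => hle q (by simp [hq]))
    obtain ⟨t, s⟩ := p
    have htk : t ≤ k * n := hle (t, s) (by simp)
    have htL : (t, s) ∈ L := hpre.subset (by simp)
    have hsub : ∀ q ∈ pre, q ∈ L := fun q hq => hpre.subset (by simp [hq])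
    have hlt : ∀ q ∈ pre, q.1 < t := fun q hq => lt_of_prefix h.sorted hpre hq
    -- The East letter `r + n` is still to come, so the next label cannot jump over it.
    have hge : ∀ r s', (r, s') ∈ pre → (∀ q ∈ pre, q.1 < r + n) →
        t ≤ r + n ∧ (t = r + n → s = Step.E) := by
      intro r s' hr hq
      have hrL := h.add_mem r s' (hsub _ hr) (hle (r, s') (by simp [hr]))
      constructor
      · by_contra hcon
        have := hq _ (mem_of_lt_of_prefix h.sorted hpre hrL (by simpa using hcon))
        exact lt_irrefl _ this
      · intro ht
        have := eq_of_fst_eq h.sorted htL hrL ht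
        simpa using congrArg Prod.snd this
    obtain ⟨c₀, F, hF⟩ : ∃ c₀ F, fillLabeled k pre = c₀ :: F := by
      rcases hh : fillLabeled k pre with _ | ⟨c, F⟩
      · simp [hh] at hfst
      · exact ⟨c, F, rfl⟩
    rw [fillLabeled_concat, map_append, filter_append, hF]
    rw [hF] at hfst hcol hserv
    simp only [head?_cons, Option.some.injEq] at hfst
    obtain ⟨r₀, s₀, hr₀, hm₀, hq₀, hl₀⟩ := hcol c₀ (by simp)
    have hdvd₀ : n ∣ r₀ := by
      have : r₀ ∈ c₀ := mem_of_head? hr₀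
      rw [hfst] at this
      simp only [mem_reverse, mem_filter, decide_eq_true_eq] at this
      exact this.2.1
    have hlt₀ := hlt _ hm₀
    have hge₀ := hge _ _ hm₀ hq₀
    -- The bottom `r₀` of the first column is a multiple of `n` and `r₀ < t ≤ r₀ + n`.
    have hdvdt : n ∣ t → t = r₀ + n := by
      intro hd
      obtain ⟨a, rfl⟩ := hd
      obtain ⟨b, rfl⟩ := hdvd₀
      simp only at hlt₀
      have hba := Nat.lt_of_mul_lt_mul_left hlt₀
      have : a ≤ b + 1 := by
        have := hge₀.1
        rw [← Nat.mul_succ] at this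
        exact Nat.le_of_mul_le_mul_left this hn
      have : a = b + 1 := by omega
      rw [this]; ring
    cases s with
    | N =>
      have hnd : ¬ (n ∣ t) := fun hd => by simpa using hge₀.2 (hdvdt hd)
      refine ⟨?_, ?_, ?_⟩
      · simp [fillStep, hfst, hnd]
      · intro c hc
        simp only [fillStep, mem_append, mem_singleton] at hc
        rcases hc with hc | rfl
        · obtain ⟨r, s, h1, h2, h3, h4⟩ := hcol c hc
          refine ⟨r, s, h1, by simp [h2], ?_, h4⟩
          intro q hq
          rcases mem_append.1 hq with hq | hq
          · exact h3 q hq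
          · obtain rfl := mem_singleton.1 hq
            have := hge _ _ h2 h3
            rcases lt_or_eq_of_le this.1 with h5 | h5
            · exact h5
            · simpa using this.2 h5
        · refine ⟨t, Step.N, rfl, by simp, ?_, by simp⟩
          intro q hq
          rcases mem_append.1 hq with hq | hq
          · have := hlt q hq; omega
          · obtain rfl := mem_singleton.1 hq
            simpa using hn
      · intro r s hr hq
        rcases mem_append.1 hr with hr | hr
        · obtain ⟨c, hc, hc'⟩ := hserv r s hr (fun q hq' => hq q (by simp [hq']))
          exact ⟨c, by simp only [fillStep]; exact mem_append_left _ hc, hc'⟩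
        · simp only [mem_singleton, Prod.mk.injEq] at hr
          exact ⟨[t], by simp [fillStep], by simp [hr.1]⟩
    | E =>
      obtain ⟨hnt, s', hs'⟩ := h.sub_mem t htL
      have hs'' : (t - n, s') ∈ pre := mem_of_lt_of_prefix h.sorted hpre hs' (by simp; omega)
      obtain ⟨c₁, hc₁, hh₁⟩ := hserv _ _ hs'' (fun q hq => by have := hlt q hq; omega)
      -- Consecutive entries of a column differ by `n`, so a column ending in `t - n` with `t ≤ kn`
      -- has at most `k` entries and is not full.
      have hlen : ∀ c ∈ c₀ :: F, c.head? = some (t - n) → c.length < k + 1 := by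
        intro c hc hh
        obtain ⟨r, s, h1, -, -, h4⟩ := hcol c hc
        rw [hh, Option.some.injEq] at h1
        have : c.length * n ≤ k * n := by omega
        have := Nat.le_of_mul_le_mul_right this hn
        omega
      -- No bottom entry `r` has been passed by `n`, so `t ≤ r + n` for all of them, and `t - n` is
      -- the smallest.
      have hmin : (activeEntries k (c₀ :: F)).min? = some (t - n) := by
        rw [min?_eq_some_iff]
        refine ⟨mem_activeEntries.2 ⟨c₁, hc₁, hlen c₁ hc₁ hh₁, hh₁⟩, ?_⟩
        intro b hb
        obtain ⟨c, hc, -, hcb⟩ := mem_activeEntries.1 hb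
        obtain ⟨r, s, h1, h2, h3, -⟩ := hcol c hc
        rw [hcb, Option.some.injEq] at h1
        have := (hge _ _ h2 h3).1
        omega
      have hstep : fillStep k (c₀ :: F) t Step.E =
          (c₀ :: F).map fun c => if c.head? = some (t - n) then t :: c else c := by
        simp only [fillStep, hmin]
        refine map_congr_left fun c hc => ?_
        by_cases hh : c.head? = some (t - n)
        · rw [if_pos ⟨hlen c hc hh, hh⟩, if_pos hh]
        · rw [if_neg (fun h => hh h.2), if_neg hh]
      simp only
      rw [hstep]
      refine ⟨?_, ?_, ?_⟩
      · simp only [map_cons, head?_cons, Option.some.injEq, map_nil]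
        by_cases hd : n ∣ t
        · have := hdvdt hd
          rw [if_pos (by rw [hr₀]; congr 1; omega), hfst]
          simp [hd, htk]
        · rw [if_neg, hfst]
          · simp [hd]
          · rw [hr₀, Option.some.injEq]
            intro hcon
            apply hd
            have : t = r₀ + n := by omega
            rw [this]
            exact Dvd.dvd.add hdvd₀ (dvd_refl n)
      · intro c hc
        obtain ⟨d, hd, rfl⟩ := mem_map.1 hc
        obtain ⟨r, s, h1, h2, h3, h4⟩ := hcol d hd
        by_cases hh : d.head? = some (t - n)
        · rw [if_pos hh]
          refine ⟨t, Step.E, rfl, by simp, ?_, ?_⟩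
          · intro q hq
            rcases mem_append.1 hq with hq | hq
            · have := hlt q hq; omega
            · obtain rfl := mem_singleton.1 hq
              simpa using hn
          · rw [hh, Option.some.injEq] at h1
            rw [length_cons, Nat.succ_mul]
            omega
        · rw [if_neg hh]
          refine ⟨r, s, h1, by simp [h2], ?_, h4⟩
          intro q hq
          rcases mem_append.1 hq with hq | hq
          · exact h3 q hq
          · obtain rfl := mem_singleton.1 hq
            have h5 := (hge _ _ h2 h3).1
            rw [h1, Option.some.injEq] at hh
            simp only
            omega
      · intro r s hr hq
        rcases mem_append.1 hr with hr | hr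
        · obtain ⟨c, hc, hc'⟩ := hserv r s hr (fun q hq' => hq q (by simp [hq']))
          refine ⟨c, mem_map.2 ⟨c, hc, ?_⟩, hc'⟩
          have := hq (t, Step.E) (by simp)
          rw [if_neg]
          rw [hc', Option.some.injEq]
          simp only at this
          omega
        · simp only [mem_singleton, Prod.mk.injEq] at hr
          refine ⟨t :: c₁, mem_map.2 ⟨c₁, hc₁, by rw [if_pos hh₁]⟩, by simp [hr.1]⟩

/-- The first column of the filling by ranks consists of the multiples of `n` up to `k * n`. -/
lemma IsRankSystem.head?_fillLabeled {k n : ℕ} {L : List (ℕ × Step)} (h : IsRankSystem k n L)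
    {pre : List (ℕ × Step)} (hpre : pre <+: L) (hne : pre ≠ []) :
    (fillLabeled k pre).head? = some ((pre.map Prod.fst).filter
      (fun r => decide (n ∣ r ∧ r ≤ k * n))).reverse := by
  induction pre using List.reverseRecOn with
  | nil => simp at hne
  | append_singleton pre p ih =>
    by_cases hp : p.1 ≤ k * n
    · refine (h.initial_phase hpre hne fun q hq => ?_).1
      rcases mem_append.1 hq with hq | hq
      · have := lt_of_prefix h.sorted hpre hq
        omega
      · obtain rfl := mem_singleton.1 hq
        exact hp
    rcases eq_or_ne pre [] with rfl | hne'
    · obtain rfl := h.eq_zero_of_prefix hpre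
      simp at hp
    have hpre' := (prefix_append _ _).trans hpre
    have ih := ih hpre' hne'
    -- Once a label exceeds `kn`, all `k + 1` multiples have been placed: the first column is full
    -- and no longer changes.
    have hlen : ((pre.map Prod.fst).filter
      (fun r => decide (n ∣ r ∧ r ≤ k * n))).reverse.length = k + 1 := by
      rw [filter_dvd_eq _ h.n_pos]
      · simp
      · intro j hj
        obtain ⟨s, hs⟩ := h.mul_mem (j := j) (by omega)
        have := Nat.mul_le_mul_right n hj
        exact mem_map.2 ⟨_, mem_of_lt_of_prefix h.sorted hpre hs (by simp only; omega), rfl⟩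
      · rw [pairwise_map]
        exact h.sorted.sublist hpre'.sublist
    rw [map_append, filter_append, fillLabeled_concat]
    set c := ((pre.map Prod.fst).filter (fun r => decide (n ∣ r ∧ r ≤ k * n))).reverse with hc
    have h0 : filter (fun r => decide (n ∣ r ∧ r ≤ k * n)) (map Prod.fst [p]) = [] := by
      simp [hp]
    rw [h0, append_nil, ← hc]
    rcases hF : fillLabeled k pre with _ | ⟨d, F⟩
    · simp [hF] at ih
    · rw [hF] at ih
      simp only [head?_cons, Option.some.injEq] at ih
      subst ih
      rcases p with ⟨t, _ | _⟩
      · simp [fillStep]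
      · simp only [fillStep, map_cons, head?_cons, Option.some.injEq]
        rw [if_neg]
        intro h
        omega

lemma card_filter_fin (k : ℕ) (p : ℕ → Prop) [DecidablePred p] :
    (Finset.univ.filter (fun s : Fin (k + 1) => p s)).card =
      (range (k + 1)).countP (fun j => decide (p j)) := by
  rw [← List.map_coe_finRange_eq_range, countP_map]
  rw [Finset.card, Finset.filter_val, Fin.univ_def]
  simp only [Multiset.filter_coe, Multiset.coe_card, countP_eq_length_filter]
  rfl

/-- The label `(k+1)n` occurs, so the last letter, which `tableau` does not read, is not one of the
letters of the first column. -/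
lemma IsRankSystem.exists_last {k n : ℕ} {L : List (ℕ × Step)} (h : IsRankSystem k n L) :
    ∃ Q l, L = Q ++ [l] ∧ k * n < l.1 := by
  rcases eq_nil_or_concat L with rfl | ⟨Q, l, rfl⟩
  · simpa using h.zero_mem
  · rw [concat_eq_append] at h
    refine ⟨Q, l, concat_eq_append, ?_⟩
    obtain ⟨s, hs⟩ := h.mul_mem le_rfl
    have hn := h.n_pos
    have hlt : k * n < (k + 1) * n := by rw [Nat.succ_mul]; omega
    rcases mem_append.1 hs with hs | hs
    · have := lt_of_prefix h.sorted (prefix_refl _) hs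
      simp only at this
      omega
    · obtain rfl := mem_singleton.1 hs
      exact hlt

lemma IsRankSystem.fillLabeled_eq {k n : ℕ} {Q : List (ℕ × Step)} {l : ℕ × Step}
    (h : IsRankSystem k n (Q ++ [l])) (hl : k * n < l.1) :
    (Q.map Prod.fst).filter (fun r => decide (n ∣ r ∧ r ≤ k * n)) = (range (k + 1)).map (· * n) ∧
    fillLabeled k Q = ((range (k + 1)).map (· * n)).reverse ::
      fillLabeled k (Q.filter fun p => decide (¬ (n ∣ p.1 ∧ p.1 ≤ k * n))) := by
  have h1 : (Q.map Prod.fst).filter (fun r => decide (n ∣ r ∧ r ≤ k * n)) =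
      (range (k + 1)).map (· * n) := by
    refine filter_dvd_eq ?_ h.n_pos ?_
    · rw [pairwise_map]
      exact h.sorted.sublist (sublist_append_left _ _)
    · intro j hj
      obtain ⟨s, hs⟩ := h.mul_mem (j := j) (by omega)
      have := Nat.mul_le_mul_right n hj
      exact mem_map.2 ⟨_, mem_of_lt_of_prefix h.sorted (prefix_refl _) hs (by simp only; omega), rfl⟩
  refine ⟨h1, ?_⟩
  have hne : Q ≠ [] := by
    rintro rfl
    simp at h1
  have h2 := h.head?_fillLabeled (prefix_append Q [l]) hne
  rw [h1] at h2
  rw [← tail_fillLabeled k (fun r => n ∣ r ∧ r ≤ k * n)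
    (h.sorted.sublist (sublist_append_left _ _))
    (fun pre hpre hne => h.head?_fillLabeled (hpre.trans (prefix_append _ _)) hne)]
  rcases hF : fillLabeled k Q with _ | ⟨c, F⟩
  · simp [hF] at h2
  · simp only [hF, head?_cons, Option.some.injEq] at h2
    rw [h2, tail_cons]

lemma IsRankSystem.tableau_zero {k n : ℕ} {L : List (ℕ × Step)} (h : IsRankSystem k n L)
    (r : Fin (k + 1)) :
    tableau k n (L.map Prod.snd) r ⟨0, h.n_pos⟩ = pos L (r * n) := by
  obtain ⟨Q, l, rfl, hl⟩ := h.exists_last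
  have hr : (r : ℕ) * n ≤ k * n := Nat.mul_le_mul_right n (by omega)
  have hpos : pos (Q ++ [l]) (r * n) = pos Q (r * n) := by
    simp only [pos, countP_append, countP_singleton]
    rw [if_neg (by simp only [decide_eq_true_eq]; omega)]
    rfl
  rw [hpos]
  simp only [tableau, map_append, map_singleton, dropLast_concat]
  rw [fill_map_snd k (h.sorted.sublist (sublist_append_left _ _)), (h.fillLabeled_eq hl).2]
  have h1 := r.2
  simp [getD_eq_getElem?_getD, getElem?_range h1]

/-! ### Deleting the first column -/

/-- The second summand is the number of first-column labels up to `y`, exactly what `red` subtracts.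
-/
lemma pos_filter_add {Q : List (ℕ × Step)} {k n y : ℕ}
    (hQ : (Q.map Prod.fst).filter (fun r => decide (n ∣ r ∧ r ≤ k * n)) =
      (range (k + 1)).map (· * n)) :
    pos Q y = pos (Q.filter fun p => decide (¬ (n ∣ p.1 ∧ p.1 ≤ k * n))) y +
      (range (k + 1)).countP (fun j => decide (j * n ≤ y)) := by
  have h1 : (range (k + 1)).countP (fun j => decide (j * n ≤ y)) =
      ((range (k + 1)).map (· * n)).countP (fun r => decide (r ≤ y)) := by
    rw [countP_map]; rfl
  rw [h1, ← hQ, filter_map, countP_map, pos, pos,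
    countP_eq_countP_filter_add Q _ (fun p => decide (n ∣ p.1 ∧ p.1 ≤ k * n)), add_comm]
  congr 2
  refine filter_congr fun p _ => ?_
  rw [decide_not]

/-- Deleting the first column of a tableau amounts to deleting from the word the steps whose ranks
are multiples of `n' + 1` up to `k * (n' + 1)`. -/
lemma IsRankSystem.red_tableau {k n' : ℕ} {L : List (ℕ × Step)} (h : IsRankSystem k (n' + 1) L) :
    red (tableau k (n' + 1) (L.map Prod.snd)) = tableau k n'
      ((L.filter fun p => decide (¬ ((n' + 1) ∣ p.1 ∧ p.1 ≤ k * (n' + 1)))).map Prod.snd) := by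
  have h0 : ∀ s, tableau k (n' + 1) (L.map Prod.snd) s 0 = pos L (s * (n' + 1)) := h.tableau_zero
  ext r c
  simp only [red, h0]
  obtain ⟨Q, l, rfl, hl⟩ := h.exists_last
  have hsQ := h.sorted.sublist (sublist_append_left Q [l])
  obtain ⟨hZ, hfill⟩ := h.fillLabeled_eq hl
  have hnl : filter (fun p : ℕ × Step => decide (¬ ((n' + 1) ∣ p.1 ∧ p.1 ≤ k * (n' + 1)))) [l]
      = [l] := by
    rw [filter_cons_of_pos, filter_nil]
    simp only [decide_eq_true_eq]
    omega
  rw [filter_append, hnl]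
  simp only [tableau, map_append, map_singleton, dropLast_concat]
  rw [fill_map_snd k hsQ, fill_map_snd k (hsQ.filter _), hfill]
  set Q' := Q.filter fun p => decide (¬ ((n' + 1) ∣ p.1 ∧ p.1 ≤ k * (n' + 1))) with hQ'
  have hcol : ∀ f : ℕ → ℕ, ((fillLabeled k Q').map (List.map f)).getD c [] =
      ((fillLabeled k Q').getD c []).map f := fun f => by
    rw [← List.getD_map (f := List.map f), map_nil]
  simp only [map_cons, Fin.val_succ, getD_cons_succ, hcol]
  set col := (fillLabeled k Q').getD c [] with hcoldef
  rw [← map_reverse, ← map_reverse]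
  by_cases hr : (r : ℕ) < col.reverse.length
  · rw [getD_eq_getElem _ _ (by simpa using hr), getD_eq_getElem _ _ (by simpa using hr),
      getElem_map, getElem_map]
    set y := col.reverse[(r : ℕ)] with hy
    have hycol : y ∈ col := mem_reverse.1 (getElem_mem hr)
    have hmem : ∃ s, (y, s) ∈ Q' := by
      by_cases hc : (c : ℕ) < (fillLabeled k Q').length
      · rw [hcoldef, getD_eq_getElem _ _ hc] at hycol
        exact mem_of_mem_fillLabeled (getElem_mem hc) hycol
      · rw [hcoldef, getD_eq_default _ _ (by omega)] at hycol
        simp at hycol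
    obtain ⟨s, hs⟩ := hmem
    obtain ⟨hsQ', hyZ⟩ := mem_filter.1 hs
    simp only [decide_eq_true_eq] at hyZ
    rw [pos_filter_add hZ, ← hQ', card_filter_fin k (fun j =>
      pos (Q ++ [l]) (j * (n' + 1)) < pos Q' y + countP (fun j => decide (j * (n' + 1) ≤ y))
        (range (k + 1)))]
    -- As `pos` is strictly increasing on the labels and `y` is not in the first column, comparing
    -- positions is the same as comparing ranks.
    have : countP (fun j => decide (pos (Q ++ [l]) (j * (n' + 1)) <
        pos Q' y + countP (fun j => decide (j * (n' + 1) ≤ y)) (range (k + 1)))) (range (k + 1)) =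
        countP (fun j => decide (j * (n' + 1) ≤ y)) (range (k + 1)) := by
      refine countP_congr fun j hj => ?_
      rw [mem_range] at hj
      simp only [decide_eq_true_eq]
      rw [hQ', ← pos_filter_add hZ]
      have hjk : j * (n' + 1) ≤ k * (n' + 1) := Nat.mul_le_mul_right _ (by omega)
      have hyl := lt_of_prefix h.sorted (prefix_refl _) hsQ'
      have hposj : pos (Q ++ [l]) (j * (n' + 1)) = pos Q (j * (n' + 1)) := by
        simp only [pos, countP_append, countP_singleton]
        rw [if_neg (by simp only [decide_eq_true_eq]; omega)]
        rfl
      rw [hposj]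
      constructor
      · intro hlt
        by_contra hcon
        exact absurd (pos_mono Q (not_le.1 hcon).le) (not_le.2 hlt)
      · intro hle
        refine pos_lt (lt_of_le_of_ne hle ?_) hsQ'
        intro hcon
        rw [← hcon] at hyZ
        exact hyZ ⟨Dvd.intro_left _ rfl, hjk⟩
    rw [this]
    omega
  -- Outside the filling both sides are the default `0`, which truncated subtraction preserves.
  · rw [getD_eq_default _ _ (by simpa using hr), getD_eq_default _ _ (by simpa using hr)]
    simp

/-! ### Comparing the rank systems of `n` and `n + 1` -/

/-- The quantity `k·#N - #E` does not involve `n`, so passing to `n + 1` just adds it to the rank.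
-/
lemma ht_eq (k n : ℕ) (u : List Step) : ht (k * n + 1) n u =
    n * (k * u.count Step.N - u.count Step.E : ℤ) + u.count Step.N := by
  rw [ht]; push_cast; ring

/-- Read cyclically from the cut, `u` leads to a node of `AB`, whose rank is `ht A + ht u`. -/
lemma ht_prefix_swap {k n : ℕ} {A B u v : List Step} (h : A ++ B ∈ dyckPaths (k * n + 1) n)
    (huv : B ++ A = u ++ v) : 0 ≤ ht (k * n + 1) n A + ht (k * n + 1) n u := by
  have h1 := (mem_dyckPaths_iff.1 h).2.2
  have h0 := ht_dyck h
  rw [ht_append] at h0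
  rcases append_eq_append_iff.1 huv with ⟨as, rfl, ha⟩ | ⟨bs, rfl, hb⟩
  · have := h1 as (v ++ B) (by rw [ha, append_assoc])
    rw [ht_append]; omega
  · have := h1 (A ++ u) bs (by rw [append_assoc])
    rwa [ht_append] at this

lemma count_swap {m n : ℕ} {A B : List Step} (h : A ++ B ∈ dyckPaths m n) :
    (B ++ A).count Step.N = n ∧ (B ++ A).count Step.E = m := by
  have h1 := h.1
  have h2 := h.2.1
  rw [count_append] at h1 h2 ⊢
  rw [count_append]
  omega

lemma cons_swap_append_mem {k n : ℕ} {A B : List Step} (h : A ++ B ∈ dyckPaths (k * n + 1) n)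
    (hA : ht (k * n + 1) n A ≤ k * n) :
    Step.N :: (B ++ A ++ replicate k Step.E) ∈ dyckPaths (k * (n + 1) + 1) (n + 1) := by
  obtain ⟨hN, hE⟩ := count_swap h
  have cN : (Step.N :: (B ++ A ++ replicate k Step.E)).count Step.N = n + 1 := by
    rw [count_cons, count_append, hN, count_replicate]; simp
  have cE : (Step.N :: (B ++ A ++ replicate k Step.E)).count Step.E = k * (n + 1) + 1 := by
    rw [count_cons, count_append, hE, count_replicate]; simp; ring
  refine mem_dyckPaths_iff.2 ⟨cN, cE, ?_⟩
  intro u v huv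
  rcases u with _ | ⟨s, u⟩
  · simp
  rw [cons_append, cons.injEq] at huv
  obtain ⟨rfl, huv⟩ := huv
  rcases append_eq_append_iff.1 huv with ⟨as, rfl, ha⟩ | ⟨bs, hb, -⟩
  · have h1 : ht (k * (n + 1) + 1) (n + 1) (Step.N :: (B ++ A ++ as) ++ v) = 0 := by
      rw [cons_append, append_assoc, ← ha, ht, cN, cE]; push_cast; ring
    rw [ht_append] at h1
    have h2 : v.count Step.N = 0 := by
      have : (replicate k Step.E).count Step.N = 0 := by simp [count_replicate]
      rw [ha, count_append] at this
      omega
    have h3 : ht (k * (n + 1) + 1) (n + 1) v ≤ 0 := by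
      rw [ht, h2]; push_cast
      have : (0 : ℤ) ≤ ((n : ℤ) + 1) * (v.count Step.E : ℤ) := by positivity
      linarith
    omega
  · have h1 := ht_prefix_swap h hb
    have h2 : u.count Step.N ≤ n := by rw [← hN, hb, count_append]; omega
    have h3 : u.count Step.E ≤ k * n + 1 := by rw [← hE, hb, count_append]; omega
    rw [ht_cons, ht_N, ht_eq]
    rw [ht_eq k n u] at h1
    have h4 := h1.trans (add_le_add_left hA _)
    push_cast
    set h' : ℤ := k * u.count Step.N - u.count Step.E with hh'
    -- The inequality known is `n·s + #N ≥ 0`, the one needed is `(n+1)·s + #N + 1 ≥ 0`. As `#N ≤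
    -- n`, both reduce to `s ≥ 0`, or `s = -1` and `#N = n`. For `n = 0` the bound `s ≥ -1` comes
    -- from the number of East steps.
    obtain ⟨s, hs⟩ : ∃ s, s = k + h' := ⟨_, rfl⟩
    have h5 : 0 ≤ n * s + u.count Step.N := by rw [hs]; linarith
    have h6 : (0 : ℤ) ≤ (n + 1) * s + u.count Step.N + 1 := by
      zify at h2
      rcases lt_or_ge s (-1) with h7 | h7
      · exfalso
        rcases Nat.eq_zero_or_pos n with rfl | hn
        · push_cast at h2
          have h8 : (u.count Step.N : ℤ) = 0 := by omega
          rw [h8] at hh'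
          zify at h3
          simp at h3
          omega
        · zify at hn
          nlinarith
      · rcases eq_or_lt_of_le h7 with h8 | h8
        · rw [← h8] at h5 ⊢; linarith
        · have : 0 ≤ s := by omega
          positivity
    rw [hs] at h6
    linarith

/-- The last `k` steps are East because a North step there would start below the diagonal. Cutting
the remaining word at a lowest node makes it a Dyck path after rotation, and nonnegativity of `P` at
that node bounds the rank of the cut. -/
lemma exists_cons_swap_append {k n : ℕ} {P : List Step}
    (hP : P ∈ dyckPaths (k * (n + 1) + 1) (n + 1)) : ∃ A B, B ≠ [] ∧
      A ++ B ∈ dyckPaths (k * n + 1) n ∧ ht (k * n + 1) n A ≤ k * n ∧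
      P = Step.N :: (B ++ A ++ replicate k Step.E) := by
  obtain ⟨P₁, rfl⟩ := dyck_eq_cons_N (Nat.succ_pos n) hP
  have hpre := (mem_dyckPaths_iff.1 hP).2.2
  have h0 := ht_dyck hP
  have cN := hP.1
  have cE := hP.2.1
  rw [count_cons] at cN cE
  simp only [beq_self_eq_true, if_true, add_left_inj] at cN
  have cE : P₁.count Step.E = k * (n + 1) + 1 := by simpa using cE
  have hlen := count_N_add_count_E P₁
  have hk : k ≤ P₁.length := by nlinarith
  set W := P₁.take (P₁.length - k) with hW
  have hR : P₁.drop (P₁.length - k) = replicate k Step.E := by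
    rw [eq_replicate_iff]
    refine ⟨by simp; omega, fun s hs => ?_⟩
    cases s with
    | E => rfl
    | N =>
      exfalso
      obtain ⟨x, y, hxy⟩ := append_of_mem hs
      have hP₁ : P₁ = W ++ x ++ (Step.N :: y) := by
        rw [append_assoc, ← hxy, take_append_drop]
      have h1 := hpre (Step.N :: (W ++ x)) (Step.N :: y) (by rw [cons_append, ← hP₁])
      have h2 : ht (k * (n + 1) + 1) (n + 1) (Step.N :: (W ++ x)) +
          ht (k * (n + 1) + 1) (n + 1) (Step.N :: y) = 0 := by
        rw [← ht_append, cons_append, ← hP₁, h0]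
      rw [ht_cons _ _ _ y, ht_N, ht_eq k (n + 1) y] at h2
      have h3 : y.count Step.E ≤ k := by
        have h4 := congrArg List.length hxy
        simp at h4
        have := count_N_add_count_E y
        omega
      zify at h3
      push_cast at h2
      have h5 : ((n : ℤ) + 1) * y.count Step.E ≤ (n + 1) * k := by gcongr
      have h6 : (0 : ℤ) ≤ (k * ((n : ℤ) + 1) + 1) * y.count Step.N := by positivity
      linarith
  have hP₁ : P₁ = W ++ replicate k Step.E := by rw [← hR, take_append_drop]
  have wN : W.count Step.N = n := by
    rw [hP₁, count_append, count_replicate] at cN; simpa using cN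
  have wE : W.count Step.E = k * n + 1 := by
    rw [hP₁, count_append, count_replicate] at cE
    simp at cE
    linarith
  have hW0 : ht (k * n + 1) n W = 0 := by rw [ht, wN, wE]; ring
  have hWne : W ≠ [] := by rintro h; rw [h] at wE; simp at wE
  -- The empty prefix is excluded to make `B` nonempty; `W` itself has height `0`, so the minimum is
  -- still at most `0`.
  obtain ⟨j, hj, hmin⟩ := Finset.exists_min_image (Finset.Icc 1 W.length)
    (fun j => ht (k * n + 1) n (W.take j))
    ⟨W.length, Finset.mem_Icc.2 ⟨length_pos_iff.2 hWne, le_rfl⟩⟩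
  rw [Finset.mem_Icc] at hj
  have hmin' : ∀ u v, W = u ++ v → u ≠ [] →
      ht (k * n + 1) n (W.take j) ≤ ht (k * n + 1) n u := by
    intro u v huv hu
    have := hmin u.length (Finset.mem_Icc.2 ⟨length_pos_iff.2 hu, by rw [huv]; simp⟩)
    rwa [huv, take_left, ← huv] at this
  have hBne : W.take j ≠ [] := by
    intro h
    have := congrArg List.length h
    rw [length_take, length_nil] at this
    omega
  generalize hB : W.take j = B at *
  obtain ⟨A, hA⟩ : ∃ A, W = B ++ A := ⟨W.drop j, by rw [← hB, take_append_drop]⟩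
  have hAB : ht (k * n + 1) n A = - ht (k * n + 1) n B := by
    rw [hA, ht_append] at hW0; omega
  have hB0 : ht (k * n + 1) n B ≤ 0 := by
    have := hmin' W [] (by simp) hWne
    omega
  refine ⟨A, B, hBne, mem_dyckPaths_iff.2 ⟨?_, ?_, ?_⟩, ?_, ?_⟩
  · rw [← wN, hA, count_append, count_append, add_comm]
  · rw [← wE, hA, count_append, count_append, add_comm]
  · intro u v huv
    rcases append_eq_append_iff.1 huv with ⟨as, rfl, ha⟩ | ⟨bs, rfl, hb⟩
    · rw [ht_append, hAB]
      rcases eq_or_ne as [] with rfl | has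
      · rw [ht_nil]; omega
      · have := hmin' as (v ++ A) (by rw [hA, ha, append_assoc]) has
        omega
    · have := hmin' (B ++ u) bs (by rw [hA, append_assoc]) (by simp [hBne])
      rw [ht_append] at this
      omega
  · have h1 := hpre (Step.N :: B) (A ++ replicate k Step.E) (by
      rw [cons_append, ← append_assoc, ← hA, ← hP₁])
    have h2 : B.count Step.N ≤ n := by rw [← wN, hA, count_append]; omega
    rw [ht_cons, ht_N, ht_eq] at h1
    rw [hAB, ht_eq]
    push_cast at h1
    set h' : ℤ := k * B.count Step.N - B.count Step.E with hh'
    obtain ⟨s, hs⟩ : ∃ s, s = k + h' := ⟨_, rfl⟩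
    have h6 : (0 : ℤ) ≤ (n + 1) * s + B.count Step.N + 1 := by rw [hs]; linarith
    zify at h2
    have h5 : 0 ≤ n * s + B.count Step.N := by
      rcases lt_or_ge s (-1) with h7 | h7
      · exfalso
        nlinarith
      · rcases eq_or_lt_of_le h7 with h8 | h8
        · rw [← h8] at h6 ⊢; linarith
        · have : 0 ≤ s := by omega
          positivity
    rw [hs] at h5
    linarith
  · rw [← hA, ← hP₁]

/-- Here `a = #N` and `h = k·#N - #E`. If all North steps are used, an East step still remains,
hence `#E ≤ kn` and `h ≥ 0`. -/
lemma ht_of_mem_positions {k n : ℕ} {W u : List Step} {s : Step} (hN : W.count Step.N = n)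
    (hE : W.count Step.E = k * n + 1) (hu : (u, s) ∈ positions W) : ∃ a h : ℤ, 0 ≤ a ∧ a ≤ n ∧
      (a = n → 0 ≤ h) ∧ ht (k * n + 1) n u = n * h + a ∧
      ht (k * (n + 1) + 1) (n + 1) u = (n + 1) * h + a := by
  obtain ⟨t, rfl⟩ := mem_positions.1 hu
  refine ⟨u.count Step.N, k * u.count Step.N - u.count Step.E, by positivity, ?_, ?_,
    ht_eq k n u, by rw [ht_eq]; push_cast; ring⟩
  · rw [← hN, count_append]; push_cast; linarith
  · intro ha
    have ha : u.count Step.N = n := by exact_mod_cast ha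
    have h1 := count_N_add_count_E (s :: t)
    rw [count_append] at hN hE
    simp only [length_cons] at h1
    have h2 : u.count Step.E ≤ k * n := by omega
    rw [ha]
    zify at h2
    linarith

/-- Since `0 ≤ a ≤ n`, a smaller `n·h + a` cannot have larger `h`; adding `h` to both sides thus
keeps the strict inequality. -/
lemma ht_lt_of_ht_lt {k n : ℕ} {W : List Step} {p q : List Step × Step}
    (hN : W.count Step.N = n) (hE : W.count Step.E = k * n + 1) (hp : p ∈ positions W)
    (hq : q ∈ positions W) (h : ht (k * n + 1) n p.1 < ht (k * n + 1) n q.1) :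
    ht (k * (n + 1) + 1) (n + 1) p.1 < ht (k * (n + 1) + 1) (n + 1) q.1 := by
  obtain ⟨a, x, ha0, han, -, h1, h2⟩ := ht_of_mem_positions (s := p.2) hN hE hp
  obtain ⟨b, y, hb0, hbn, -, h3, h4⟩ := ht_of_mem_positions (s := q.2) hN hE hq
  rw [h1, h3] at h
  rw [h2, h4]
  rcases le_or_gt x y with hxy | hxy
  · linarith
  · have : (n : ℤ) * (y + 1) ≤ n * x := by gcongr; omega
    linarith

/-- The nodes of `N B A E ⋯ E`, given by their ranks. -/
lemma nodes_cons_swap_append {k n : ℕ} {W : List Step} (hN : W.count Step.N = n)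
    (hE : W.count Step.E = k * n + 1) :
    (positions (Step.N :: (W ++ replicate k Step.E))).map
      (fun p => (ht (k * (n + 1) + 1) (n + 1) p.1, p.2)) =
    (0, Step.N) :: ((positions W).map fun p =>
      ((k * (n + 1) + 1 : ℤ) + ht (k * (n + 1) + 1) (n + 1) p.1, p.2)) ++
    (range k).map fun j => (((k - j : ℕ) * (n + 1) : ℤ), Step.E) := by
  have h1 : Step.N :: (W ++ replicate k Step.E) = [Step.N] ++ (W ++ replicate k Step.E) := rfl
  rw [h1, positions_append, positions_append, positions_singleton]
  simp only [map_append, map_map, map_cons, ht_nil, cons_append, nil_append]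
  congr 2
  · refine map_congr_left fun p _ => ?_
    simp only [Function.comp_apply]
    rw [ht_cons, ht_N]; push_cast; rfl
  · apply List.ext_getElem
    · simp [length_positions]
    · intro i h2 h3
      simp only [length_map, length_range] at h3
      simp only [positions, map_map, getElem_map, getElem_zipIdx, Function.comp_apply,
        getElem_range, Prod.mk.injEq, getElem_replicate, and_true]
      rw [ht_cons, ht_N, ht_append, take_replicate, ht_replicate_E, ht, hN, hE]
      push_cast [Nat.cast_sub h3.le, min_eq_left h3.le, Nat.zero_add]
      ring

/-- Rotation shifts all ranks of `AB` by a constant, and the change from `n` to `n + 1` keeps their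
order, so one sorted list `M` of the nodes of `BA` describes both words. The `k + 1` counts the
deleted letters. -/
lemma cut_swap_nodes {k n : ℕ} {A B : List Step} {L L' : List (ℕ × Step)}
    (h : A ++ B ∈ dyckPaths (k * n + 1) n)
    (hL' : IsSortedNodes (k * n + 1) n (A ++ B) L')
    (hL : IsSortedNodes (k * (n + 1) + 1) (n + 1)
      (Step.N :: (B ++ A ++ replicate k Step.E)) L) :
    (L.filter fun p => decide (¬ ((n + 1) ∣ p.1 ∧ p.1 ≤ k * (n + 1)))).map Prod.snd =
      L'.map Prod.snd ∧
    pos L (k * (n + 1)) = k + 1 + (positions (A ++ B)).countP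
      fun p => decide (ht (k * n + 1) n p.1 < ht (k * n + 1) n A) := by
  obtain ⟨hN, hE⟩ := count_swap h
  have h0 := ht_dyck h
  rw [ht_append] at h0
  have hrot : ((positions (A ++ B)).map fun p => (ht (k * n + 1) n p.1, p.2)).Perm
      ((positions (B ++ A)).map fun p =>
        (ht (k * n + 1) n A + ht (k * n + 1) n p.1, p.2)) := by
    rw [positions_append, positions_append, map_append, map_append]
    refine perm_append_comm.trans (Perm.of_eq ?_)
    rw [map_map, map_map]
    congr 1
    · refine map_congr_left fun p _ => ?_
      simp
    · refine map_congr_left fun p _ => ?_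
      simp only [Function.comp_apply, ht_append, Prod.mk.injEq, and_true]
      omega
  have hperm := hL.perm
  rw [nodes_cons_swap_append hN hE] at hperm
  set W := B ++ A with hW
  set ρ := ht (k * n + 1) n A
  -- Divisibility forces `n + 1 ∣ a + 1`, so `a = n` and `h ≥ 0`; then the rank exceeds `k(n+1)`.
  have hmid : ∀ p ∈ positions W,
      ¬ (((n + 1 : ℕ) : ℤ) ∣ (k * (n + 1) + 1 : ℤ) + ht (k * (n + 1) + 1) (n + 1) p.1 ∧
        (k * (n + 1) + 1 : ℤ) + ht (k * (n + 1) + 1) (n + 1) p.1 ≤ k * (n + 1)) := by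
    rintro p hp ⟨⟨c, hc⟩, hle⟩
    obtain ⟨a, x, ha0, han, hax, -, h2⟩ := ht_of_mem_positions (s := p.2) hN hE hp
    rw [h2] at hc hle
    push_cast at hc
    obtain ⟨d, hd⟩ : ∃ d, d = c - k - x := ⟨_, rfl⟩
    have hd' : ((n : ℤ) + 1) * d = a + 1 := by rw [hd]; linarith
    have hn0 : (0 : ℤ) ≤ n := by positivity
    have hd1 : 0 < d := by
      by_contra hcon
      have : ((n : ℤ) + 1) * d ≤ 0 := mul_nonpos_of_nonneg_of_nonpos (by omega) (by omega)
      omega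
    have hd2 : ((n : ℤ) + 1) * 1 ≤ (n + 1) * d := by gcongr; omega
    have hx := hax (by omega)
    have : (0 : ℤ) ≤ (n + 1) * x := by positivity
    linarith
  obtain ⟨M, hM, hMs⟩ := exists_sorted_perm (fun p : List Step × Step => ht (k * n + 1) n p.1)
    (positions W) (by
      refine (positions_pairwise W).imp ?_
      rintro p q ⟨v, t, hv, ht, hq, hw'⟩
      have := ht_ne_zero_of_factor hN hE hw' hv (by simp [ht])
      rw [hq, ht_append]
      omega)
  have hleft : (L.filter fun p => decide (¬ ((n + 1) ∣ p.1 ∧ p.1 ≤ k * (n + 1)))).map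
      (fun p => ((p.1 : ℤ), p.2)) =
      M.map fun p => ((k * (n + 1) + 1 : ℤ) + ht (k * (n + 1) + 1) (n + 1) p.1, p.2) := by
    apply eq_of_perm_of_sorted
    · have h1 := hperm.filter
        (fun p => decide (¬ (((n + 1 : ℕ) : ℤ) ∣ p.1 ∧ p.1 ≤ ((k * (n + 1) : ℕ) : ℤ))))
      rw [filter_map, filter_append, filter_cons_of_neg, filter_map, filter_map] at h1
      · have e1 : filter ((fun p : ℤ × Step => decide (¬ (((n + 1 : ℕ) : ℤ) ∣ p.1 ∧
            p.1 ≤ ((k * (n + 1) : ℕ) : ℤ)))) ∘ fun p : ℕ × Step => ((p.1 : ℤ), p.2)) L =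
            L.filter fun p => decide (¬ ((n + 1) ∣ p.1 ∧ p.1 ≤ k * (n + 1))) := by
          refine filter_congr fun p _ => ?_
          simp only [Function.comp_apply, Int.natCast_dvd_natCast, Nat.cast_le]
        rw [e1] at h1
        refine h1.trans ?_
        rw [filter_eq_self.2, filter_eq_nil_iff.2, map_nil, append_nil]
        · exact (hM.map _).symm
        · intro j hj
          simp only [Function.comp_apply, decide_eq_true_eq, not_not]
          refine ⟨⟨(k - j : ℕ), by push_cast; ring⟩, ?_⟩
          push_cast
          gcongr
          omega
        · intro p hp
          have := hmid p hp
          simpa only [Function.comp_apply, decide_eq_true_eq, Nat.cast_mul, Nat.cast_add,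
            Nat.cast_one] using this
      · simp only [decide_eq_true_eq, not_not]
        exact ⟨dvd_zero _, by positivity⟩
    · rw [pairwise_map]
      exact (hL.sorted.filter _).imp fun h => by simp only; omega
    · rw [pairwise_map]
      refine hMs.imp_of_mem fun {p q} hp hq hpq => ?_
      have := ht_lt_of_ht_lt hN hE (hM.subset hp) (hM.subset hq) hpq
      simp only
      omega
  have hright : L'.map (fun p => ((p.1 : ℤ), p.2)) =
      M.map fun p => (ρ + ht (k * n + 1) n p.1, p.2) := by
    apply eq_of_perm_of_sorted
    · exact hL'.perm.trans (hrot.trans (hM.map _).symm)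
    · rw [pairwise_map]
      exact hL'.sorted.imp fun h => by simp only; omega
    · rw [pairwise_map]
      exact hMs.imp fun h => by simp only; omega
  constructor
  · have e1 := congrArg (List.map Prod.snd) hleft
    have e2 := congrArg (List.map Prod.snd) hright
    rw [map_map, map_map] at e1 e2
    exact e1.trans e2.symm
  · have e1 := hperm.countP_eq (fun p => decide (p.1 ≤ ((k * (n + 1) : ℕ) : ℤ)))
    rw [countP_map, countP_append, countP_cons, countP_map, countP_map] at e1
    have e2 := hrot.countP_eq (fun p => decide (p.1 < ρ))
    rw [countP_map, countP_map] at e2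
    have e3 : pos L (k * (n + 1)) = countP ((fun p : ℤ × Step =>
        decide (p.1 ≤ ((k * (n + 1) : ℕ) : ℤ))) ∘ fun p : ℕ × Step => ((p.1 : ℤ), p.2)) L := by
      refine countP_congr fun p _ => ?_
      simp only [Function.comp_apply, Nat.cast_le]
    have e4 : countP ((fun p : ℤ × Step => decide (p.1 ≤ ((k * (n + 1) : ℕ) : ℤ))) ∘
        fun j => (((k - j : ℕ) * (n + 1) : ℤ), Step.E)) (range k) = k := by
      conv_rhs => rw [← length_range (n := k)]
      rw [countP_eq_length]
      intro j hj
      simp only [Function.comp_apply, decide_eq_true_eq]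
      push_cast
      gcongr
      omega
    rw [e3, e1, e4, if_pos (by simp only [decide_eq_true_eq]; positivity)]
    -- Both conditions say that `h < 0` (here `x`), because `a < n` whenever `h < 0`.
    have e5 : (positions (A ++ B)).countP (fun p => decide (ht (k * n + 1) n p.1 < ρ)) =
        countP ((fun p : ℤ × Step => decide (p.1 ≤ ((k * (n + 1) : ℕ) : ℤ))) ∘ fun p =>
          ((k * (n + 1) + 1 : ℤ) + ht (k * (n + 1) + 1) (n + 1) p.1, p.2)) (positions W) := by
      refine Eq.trans e2 (countP_congr fun p hp => ?_)
      obtain ⟨a, x, ha0, han, hax, h1, h2⟩ := ht_of_mem_positions (s := p.2) hN hE hp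
      simp only [Function.comp_apply, decide_eq_true_eq, h1, h2]
      push_cast
      have hn0 : (0 : ℤ) ≤ n := by positivity
      rcases lt_or_ge x 0 with hx | hx
      · have han' : a ≠ n := fun h => by have := hax h; omega
        have e6 : (n : ℤ) * x ≤ n * (-1) := by gcongr; omega
        constructor
        · intro; linarith
        · intro
          have : a < n := lt_of_le_of_ne han han'
          linarith
      · have e6 : (0 : ℤ) ≤ n * x := by positivity
        constructor <;> intro <;> linarith
    rw [e5]
    omega

/-! ### A path is determined by its tableau -/

/-- Only North steps open columns, and the top entry, listed last, never changes afterwards. -/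
lemma map_getLast?_fillLabeled (k : ℕ) (L : List (ℕ × Step)) :
    (∀ c ∈ fillLabeled k L, c ≠ []) ∧ (fillLabeled k L).map getLast? =
      (L.filter fun p => decide (p.2 = Step.N)).map fun p => some p.1 := by
  induction L using List.reverseRecOn with
  | nil => simp
  | append_singleton L p ih =>
    obtain ⟨h1, h2⟩ := ih
    rw [fillLabeled_concat]
    obtain ⟨i, s⟩ := p
    cases s with
    | N =>
      refine ⟨?_, by simp [fillStep, h2]⟩
      simp only [fillStep, mem_append, mem_singleton]
      rintro c (hc | rfl)
      · exact h1 c hc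
      · simp
    | E =>
      have h3 : filter (fun p : ℕ × Step => decide (p.2 = Step.N)) [(i, Step.E)] = [] := rfl
      rw [filter_append, h3, append_nil, ← h2]
      simp only [fillStep, mem_map, map_map]
      refine ⟨?_, map_congr_left fun c hc => ?_⟩
      · rintro _ ⟨c, hc, rfl⟩
        split
        · simp
        · exact h1 c hc
      · simp only [Function.comp_apply]
        split
        · rcases c with _ | ⟨x, c⟩
          · exact absurd rfl (h1 _ hc)
          · rw [getLast?_cons_cons]
        · rfl

/-- The positions, counted from `1`, of the North steps of `w`. -/
def northPositions (w : List Step) : List ℕ :=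
  (((w.zipIdx 1).map Prod.swap).filter fun p => decide (p.2 = Step.N)).map Prod.fst

lemma mem_northPositions {w : List Step} {i : ℕ} :
    i + 1 ∈ northPositions w ↔ w[i]? = some Step.N := by
  simp only [northPositions, mem_map, mem_filter]
  constructor
  · rintro ⟨_, ⟨⟨⟨s, j⟩, hp, rfl⟩, hs⟩, hj⟩
    simp only [Prod.fst_swap, Prod.snd_swap, decide_eq_true_eq] at hs hj
    subst hs hj
    simpa using (mk_mem_zipIdx_iff_le_and_getElem?_sub.1 hp).2
  · intro h
    exact ⟨(i + 1, Step.N), ⟨⟨(Step.N, i + 1),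
      mk_mem_zipIdx_iff_le_and_getElem?_sub.2 (by simpa using h), rfl⟩, by simp⟩, rfl⟩

lemma length_northPositions (w : List Step) : (northPositions w).length = w.count Step.N := by
  rw [northPositions, length_map, ← countP_eq_length_filter, countP_map, count]
  conv_rhs => rw [← zipIdx_map_fst 1 w, countP_map]
  exact countP_congr fun p _ => by simp [Function.comp_apply]

lemma tableau_zero_row (k n : ℕ) (D : List Step) (c : Fin n) :
    tableau k n D 0 c = (northPositions D.dropLast).getD c 0 := by
  have h := (map_getLast?_fillLabeled k ((D.dropLast.zipIdx 1).map Prod.swap)).2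
  rw [← fill_eq_fillLabeled] at h
  have h1 : (((fill k D.dropLast).map getLast?)[(c : ℕ)]?).join.getD 0 =
      tableau k n D 0 c := by
    rw [getElem?_map, tableau, getD_eq_getElem?_getD, getD_eq_getElem?_getD]
    simp only [Fin.val_zero, ← head?_eq_getElem?, head?_reverse]
    cases (fill k D.dropLast)[(c : ℕ)]? <;> simp
  rw [← h1, h, northPositions, getElem?_map, getD_eq_getElem?_getD, getElem?_map]
  cases (filter (fun p : ℕ × Step => decide (p.2 = Step.N))
    (map Prod.swap (D.dropLast.zipIdx 1)))[(c : ℕ)]? <;> simp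

/-- A path is determined by its tableau. -/
lemma tableau_injOn (k n : ℕ) : Set.InjOn (tableau k n) (dyckPaths (k * n + 1) n) := by
  intro D₁ h₁ D₂ h₂ h
  obtain ⟨w₁, rfl⟩ := dyck_eq_append_E (Nat.succ_pos _) h₁
  obtain ⟨w₂, rfl⟩ := dyck_eq_append_E (Nat.succ_pos _) h₂
  have c₁ : w₁.count Step.N = n := by have := h₁.1; rw [count_append] at this; simpa using this
  have c₂ : w₂.count Step.N = n := by have := h₂.1; rw [count_append] at this; simpa using this
  have hlen : w₁.length = w₂.length := by
    have e₁ := length_dyck h₁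
    have e₂ := length_dyck h₂
    rw [length_append] at e₁ e₂
    omega
  have hpos : northPositions w₁ = northPositions w₂ := by
    apply List.ext_getElem
    · rw [length_northPositions, length_northPositions, c₁, c₂]
    · intro i hi₁ hi₂
      have hi : i < n := by rwa [length_northPositions, c₁] at hi₁
      -- The top row alone suffices: it lists the positions of the North steps.
      have := congrFun (congrFun h 0) ⟨i, hi⟩
      rw [tableau_zero_row, tableau_zero_row, dropLast_concat, dropLast_concat,
        getD_eq_getElem _ _ hi₁, getD_eq_getElem _ _ hi₂] at this
      exact this
  congr 1
  apply List.ext_getElem hlen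
  intro i hi₁ hi₂
  have h1 := mem_northPositions (w := w₁) (i := i)
  rw [hpos, mem_northPositions, getElem?_eq_getElem hi₁, getElem?_eq_getElem hi₂,
    Option.some.injEq, Option.some.injEq] at h1
  cases e₁ : w₁[i] <;> cases e₂ : w₂[i] <;> simp_all

/-! ### Every tableau comes from a path -/

lemma filter_finRange_succ {n : ℕ} {f : Fin n → ℕ} (hf : StrictMono f) (a : Fin n) :
    (finRange n).filter (fun x => decide (f x < f a + 1)) =
      (finRange n).filter (fun x => decide (f x < f a)) ++ [a] := by
  have hs : (finRange n).Pairwise (· < ·) := pairwise_lt_finRange n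
  have h1 := hs.filter (fun x => decide (f x < f a + 1))
  have h2 : ((finRange n).filter (fun x => decide (f x < f a)) ++ [a]).Pairwise (· < ·) := by
    rw [pairwise_append]
    refine ⟨hs.filter _, by simp, fun x hx y hy => ?_⟩
    obtain rfl := mem_singleton.1 hy
    simpa [hf.lt_iff_lt] using (mem_filter.1 hx).2
  refine Perm.eq_of_pairwise (le := (· < ·)) (fun a b _ _ hab hba => absurd hab hba.asymm) h1 h2 ?_
  rw [perm_ext_iff_of_nodup (h1.imp ne_of_lt) (h2.imp ne_of_lt)]
  intro x
  simp only [mem_filter, mem_finRange, true_and, mem_append, mem_singleton, decide_eq_true_eq,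
    Nat.lt_succ_iff_lt_or_eq, hf.injective.eq_iff]

/-- The entries below `t` in column `c` of `T`, from bottom to top. -/
def partialColumn {k n : ℕ} (T : Matrix (Fin (k + 1)) (Fin n) ℕ) (t : ℕ) (c : Fin n) : List ℕ :=
  (((finRange (k + 1)).filter fun r => decide (T r c < t)).map fun r => T r c).reverse

/-- The columns formed by the entries below `t` of `T`. -/
def partialFilling {k n : ℕ} (T : Matrix (Fin (k + 1)) (Fin n) ℕ) (t : ℕ) : List (List ℕ) :=
  ((finRange n).filter fun c => decide (T 0 c < t)).map (partialColumn T t)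

variable {k n : ℕ} {T : Matrix (Fin (k + 1)) (Fin n) ℕ}

lemma IsFussTableau.eq_of_eq (hT : IsFussTableau k n T) {r r' : Fin (k + 1)} {c c' : Fin n}
    (h : T r c = T r' c') : r = r' ∧ c = c' := by
  have := hT.bijOn.injOn (Set.mem_univ (r, c)) (Set.mem_univ (r', c')) h
  simpa using this

lemma partialColumn_succ_self (hT : IsFussTableau k n T) (r : Fin (k + 1)) (c : Fin n) :
    partialColumn T (T r c + 1) c = T r c :: partialColumn T (T r c) c := by
  rw [partialColumn, filter_finRange_succ (hT.col_increasing c) r]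
  simp [partialColumn]

lemma partialColumn_succ_of_ne {t : ℕ} {c : Fin n} (h : ∀ r, T r c ≠ t) :
    partialColumn T (t + 1) c = partialColumn T t c := by
  rw [partialColumn, partialColumn]
  congr 2
  refine filter_congr fun r _ => ?_
  have := h r
  rw [decide_eq_decide]
  omega

lemma partialColumn_eq_nil (hT : IsFussTableau k n T) (c : Fin n) :
    partialColumn T (T 0 c) c = [] := by
  rw [partialColumn, filter_eq_nil_iff.2]
  · rfl
  · intro r _
    simpa using (hT.col_increasing c).monotone (Fin.zero_le r)

lemma partialColumn_succ_row (hT : IsFussTableau k n T) (i : Fin k) (c : Fin n) :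
    partialColumn T (T i.succ c) c =
      T i.castSucc c :: partialColumn T (T i.castSucc c) c := by
  rw [← partialColumn_succ_self hT, partialColumn, partialColumn]
  congr 2
  refine filter_congr fun r _ => ?_
  rw [decide_eq_decide, (hT.col_increasing c).lt_iff_lt, Nat.lt_succ_iff,
    (hT.col_increasing c).le_iff_le, Fin.lt_def, Fin.le_def]
  simp only [Fin.val_succ, Fin.val_castSucc]
  omega

lemma exists_of_head?_partialColumn {t y : ℕ} {c : Fin n}
    (h : (partialColumn T t c).head? = some y) :
    ∃ s, y = T s c ∧ ∀ s', T s' c < t → s' ≤ s := by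
  rw [partialColumn, head?_reverse, getLast?_map, Option.map_eq_some_iff] at h
  obtain ⟨s, hs, rfl⟩ := h
  obtain ⟨l, hl⟩ := getLast?_eq_some_iff.1 hs
  refine ⟨s, rfl, fun s' hs' => ?_⟩
  have hp : ((finRange (k + 1)).filter fun r => decide (T r c < t)).Pairwise (· < ·) :=
    (pairwise_lt_finRange _).filter _
  have hm : s' ∈ (finRange (k + 1)).filter fun r => decide (T r c < t) := by
    simpa using hs'
  rw [hl] at hp hm
  rcases mem_append.1 hm with h | h
  · exact ((pairwise_append.1 hp).2.2 _ h s (by simp)).le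
  · exact (mem_singleton.1 h).le

lemma length_partialColumn_lt_iff {t : ℕ} {c : Fin n} :
    (partialColumn T t c).length < k + 1 ↔ ∃ r, t ≤ T r c := by
  rw [partialColumn, length_reverse, length_map]
  have hl : (finRange (k + 1)).length = k + 1 := length_finRange
  rw [← not_iff_not, not_lt]
  have h1 := length_filter_le (fun r => decide (T r c < t)) (finRange (k + 1))
  constructor
  · intro h
    have := length_filter_eq_length_iff.1 (le_antisymm h1 (hl.le.trans h))
    simpa using this
  · intro h
    rw [length_filter_eq_length_iff.2, hl]
    simpa using h

/-- One stage of the Filling Algorithm on the word of a tableau. -/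
lemma partialFilling_succ (hT : IsFussTableau k n T) (r : Fin (k + 1)) (c : Fin n) :
    partialFilling T (T r c + 1) =
      fillStep k (partialFilling T (T r c)) (T r c) (if r = 0 then Step.N else Step.E) := by
  rcases Fin.eq_zero_or_eq_succ r with rfl | ⟨i, rfl⟩
  · rw [if_pos rfl, fillStep, partialFilling, filter_finRange_succ (hT.row_increasing 0) c,
      map_append, map_singleton, partialColumn_succ_self hT, partialColumn_eq_nil hT,
      partialFilling]
    congr 1
    refine map_congr_left fun c' hc' => partialColumn_succ_of_ne fun s hs => ?_
    have := (hT.eq_of_eq hs).2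
    subst this
    simp at hc'
  · rw [if_neg (Fin.succ_ne_zero i)]
    set t := T i.succ c with ht
    have hc0 : T 0 c < t := hT.col_increasing c (Fin.succ_pos i)
    have hne : ∀ c', c' ≠ c → ∀ s, T s c' ≠ t := fun c' hc' s hs => hc' (hT.eq_of_eq hs).2
    have hhead : (partialColumn T t c).head? = some (T i.castSucc c) := by
      rw [ht, partialColumn_succ_row hT]; rfl
    have hlen : (partialColumn T t c).length < k + 1 :=
      length_partialColumn_lt_iff.2 ⟨i.succ, le_rfl⟩
    have hmin : (activeEntries k (partialFilling T t)).min? = some (T i.castSucc c) := by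
      rw [min?_eq_some_iff]
      refine ⟨mem_activeEntries.2 ⟨_, mem_map.2 ⟨c, ?_, rfl⟩, hlen, hhead⟩, ?_⟩
      · simpa using hc0
      · intro y hy
        obtain ⟨_, hd, hl, hh⟩ := mem_activeEntries.1 hy
        obtain ⟨c', hc', rfl⟩ := mem_map.1 hd
        rcases eq_or_ne c' c with rfl | hcc
        · rw [hhead, Option.some.injEq] at hh
          exact hh.le
        · obtain ⟨s, rfl, hs⟩ := exists_of_head?_partialColumn hh
          obtain ⟨q, hq⟩ := length_partialColumn_lt_iff.1 hl
          -- If a smaller entry were active in column `c'`, the entry below it would exceed `t`.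
          -- Then `t` and the entry above `t` would lie between vertical neighbours of `c'`,
          -- contrary to `strip`.
          by_contra hcon
          have hslt : T s c' < t := (not_le.1 hcon).trans
            (hT.col_increasing c (Fin.castSucc_lt_succ (i := i)))
          have hsq : s < q := (hT.col_increasing c').lt_iff_lt.1 (hslt.trans_le hq)
          have hsl : s ≠ Fin.last k := fun h => absurd (Fin.le_last q) (by rw [← h]; exact hsq.not_ge)
          obtain ⟨j, rfl⟩ := Fin.exists_castSucc_eq.2 hsl
          refine hT.strip j c' i.castSucc i.succ c ⟨not_le.1 hcon,
            hT.col_increasing c (Fin.castSucc_lt_succ (i := i)), ?_⟩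
          have h1 := hne c' hcc j.succ
          rcases lt_or_ge (T j.succ c') t with h2 | h2
          · exact absurd (hs _ h2) (not_le.2 (Fin.castSucc_lt_succ (i := j)))
          · exact lt_of_le_of_ne h2 h1.symm
    rw [fillStep, hmin]
    have hfil : (finRange n).filter (fun c' => decide (T 0 c' < t + 1)) =
        (finRange n).filter (fun c' => decide (T 0 c' < t)) := by
      refine filter_congr fun c' _ => ?_
      have : T 0 c' ≠ t := fun h => Fin.succ_ne_zero i (hT.eq_of_eq h).1.symm
      rw [decide_eq_decide]
      omega
    rw [partialFilling, hfil, partialFilling, map_map]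
    refine map_congr_left fun c' hc' => ?_
    simp only [Function.comp_apply]
    rcases eq_or_ne c' c with rfl | hcc
    · rw [if_pos ⟨hlen, hhead⟩, ht, partialColumn_succ_self hT]
    · rw [partialColumn_succ_of_ne (hne c' hcc), if_neg]
      rintro ⟨-, h⟩
      obtain ⟨s, hs, -⟩ := exists_of_head?_partialColumn h
      exact hcc (hT.eq_of_eq hs).2.symm

open Classical in
/-- The step placing the entry `i` of `T`: a North step if `i` is in the top row. -/
noncomputable def stepAt (T : Matrix (Fin (k + 1)) (Fin n) ℕ) (i : ℕ) : Step :=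
  if ∃ c, T 0 c = i then Step.N else Step.E

lemma IsFussTableau.exists_eq (hT : IsFussTableau k n T) {i : ℕ} (hi : i < (k + 1) * n) :
    ∃ r c, T r c = i + 1 := by
  obtain ⟨⟨r, c⟩, -, h⟩ := hT.bijOn.surjOn (show i + 1 ∈ Set.Icc 1 ((k + 1) * n) from ⟨by omega, hi⟩)
  exact ⟨r, c, h⟩

lemma IsFussTableau.one_le (hT : IsFussTableau k n T) (r : Fin (k + 1)) (c : Fin n) :
    1 ≤ T r c ∧ T r c ≤ (k + 1) * n := hT.bijOn.mapsTo (Set.mem_univ (r, c))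

lemma IsFussTableau.fillLabeled_stepAt (hT : IsFussTableau k n T) {i : ℕ} (hi : i ≤ (k + 1) * n) :
    fillLabeled k ((range i).map fun j => (j + 1, stepAt T (j + 1))) =
      partialFilling T (i + 1) := by
  induction i with
  | zero =>
    rw [partialFilling, filter_eq_nil_iff.2]
    · rfl
    · intro c _
      have := (hT.one_le 0 c).1
      simp only [decide_eq_true_eq]
      omega
  | succ i ih =>
    obtain ⟨r, c, hrc⟩ := hT.exists_eq (Nat.lt_of_succ_le hi)
    rw [range_succ, map_append, map_singleton, fillLabeled_concat, ih (by omega), ← hrc,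
      partialFilling_succ hT]
    congr 1
    rw [stepAt]
    by_cases hr : r = 0
    · rw [if_pos hr, if_pos ⟨c, by rw [hr]⟩]
    · rw [if_neg hr, if_neg]
      rintro ⟨c', hc'⟩
      exact hr (hT.eq_of_eq hc').1.symm

/-- The word whose filling is `T`. -/
noncomputable def wordOf (T : Matrix (Fin (k + 1)) (Fin n) ℕ) (i : ℕ) : List Step :=
  (range i).map fun j => stepAt T (j + 1)

lemma zipIdx_wordOf (T : Matrix (Fin (k + 1)) (Fin n) ℕ) (i : ℕ) :
    ((wordOf T i).zipIdx 1).map Prod.swap =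
      (range i).map fun j => (j + 1, stepAt T (j + 1)) := by
  apply List.ext_getElem
  · simp [wordOf]
  · intro j h1 h2
    simp [wordOf, add_comm]

lemma IsFussTableau.tableau_wordOf (hT : IsFussTableau k n T) :
    tableau k n (wordOf T ((k + 1) * n) ++ [Step.E]) = T := by
  ext r c
  rw [tableau, dropLast_concat, fill_eq_fillLabeled, zipIdx_wordOf,
    hT.fillLabeled_stepAt le_rfl, partialFilling, filter_eq_self.2]
  · have e : ((finRange n).map (partialColumn T ((k + 1) * n + 1))).getD c [] =
        partialColumn T ((k + 1) * n + 1) c := by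
      rw [getD_eq_getElem _ _ (by simp)]
      simp
    rw [e, partialColumn, reverse_reverse, filter_eq_self.2]
    · rw [getD_eq_getElem _ _ (by simpa using Nat.le_of_lt_succ r.2)]
      simp
    · intro s _
      have := (hT.one_le s c).2
      simp only [decide_eq_true_eq]
      omega
  · intro c _
    have := (hT.one_le 0 c).2
    simp only [decide_eq_true_eq]
    omega

lemma IsFussTableau.count_wordOf (hT : IsFussTableau k n T) {i : ℕ} (hi : i ≤ (k + 1) * n) :
    (wordOf T i).count Step.N = (Finset.univ.filter fun c => T 0 c < i + 1).card := by
  have h := (map_getLast?_fillLabeled k ((range i).map fun j => (j + 1, stepAt T (j + 1)))).2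
  have h1 := congrArg List.length h
  rw [length_map, length_map, hT.fillLabeled_stepAt hi, ← zipIdx_wordOf,
    ← length_map (f := Prod.fst)] at h1
  rw [← length_northPositions]
  refine h1.symm.trans ?_
  rw [partialFilling, length_map, Finset.card, Finset.filter_val, Fin.univ_def]
  rfl

/-- The entries `1, …, i` lie in columns whose top is at most `i`, and each column has `k + 1`
cells. -/
lemma IsFussTableau.count_E_wordOf_le (hT : IsFussTableau k n T) {i : ℕ} (hi : i ≤ (k + 1) * n) :
    (wordOf T i).count Step.E ≤ k * (wordOf T i).count Step.N := by
  have h1 := count_N_add_count_E (wordOf T i)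
  have h2 : (wordOf T i).length = i := by simp [wordOf]
  have h3 : i ≤ (k + 1) * (wordOf T i).count Step.N := by
    rw [hT.count_wordOf hi]
    have h4 : (Finset.Icc 1 i).card ≤ ((Finset.univ : Finset (Fin (k + 1))) ×ˢ
        (Finset.univ.filter fun c => T 0 c < i + 1)).card := by
      refine Finset.card_le_card_of_surjOn (fun p => T p.1 p.2) ?_
      intro x hx
      rw [Finset.coe_Icc] at hx
      obtain ⟨r, c, hrc⟩ := hT.exists_eq (i := x - 1) (by have := hx.1; have := hx.2; omega)
      have hx1 := hx.1
      have hx2 := hx.2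
      have : T 0 c ≤ T r c := (hT.col_increasing c).monotone (Fin.zero_le r)
      refine ⟨(r, c), ?_, by simp only; omega⟩
      simp only [Finset.coe_product, Set.mem_prod, Finset.mem_coe, Finset.mem_univ, true_and,
        Finset.mem_filter]
      omega
    simpa using h4
  rw [h2] at h1
  rw [Nat.succ_mul] at h3
  omega

lemma take_wordOf (T : Matrix (Fin (k + 1)) (Fin n) ℕ) {i j : ℕ} (h : i ≤ j) :
    (wordOf T j).take i = wordOf T i := by
  rw [wordOf, ← map_take, take_range, min_eq_left h, wordOf]

lemma mem_dyckPaths_of_count_le {w : List Step} (hN : w.count Step.N = n)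
    (hE : w.count Step.E = k * n) (h : ∀ u v, w = u ++ v → u.count Step.E ≤ k * u.count Step.N) :
    w ++ [Step.E] ∈ dyckPaths (k * n + 1) n := by
  have cN : (w ++ [Step.E]).count Step.N = n := by rw [count_append, hN]; rfl
  have cE : (w ++ [Step.E]).count Step.E = k * n + 1 := by rw [count_append, hE]; rfl
  refine mem_dyckPaths_iff.2 ⟨cN, cE, ?_⟩
  intro u v huv
  have hu : u <+: w ++ [Step.E] := ⟨v, huv.symm⟩
  rcases prefix_concat_iff.1 hu with rfl | ⟨v', hv'⟩
  · rw [ht, cN, cE]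
    push_cast
    linarith
  · have := h u v' hv'.symm
    rw [ht_eq]
    zify at this
    have h1 : (0 : ℤ) ≤ n * (k * u.count Step.N - u.count Step.E : ℤ) :=
      mul_nonneg (by positivity) (by linarith)
    have h2 : (0 : ℤ) ≤ u.count Step.N := by positivity
    linarith

/-- Every tableau is the tableau of a path. -/
lemma IsFussTableau.exists_dyckPath (hT : IsFussTableau k n T) :
    ∃ D, D ∈ dyckPaths (k * n + 1) n ∧ tableau k n D = T := by
  refine ⟨_, ?_, hT.tableau_wordOf⟩
  have cN : (wordOf T ((k + 1) * n)).count Step.N = n := by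
    rw [hT.count_wordOf le_rfl, Finset.filter_true_of_mem]
    · simp
    · intro c _
      have := (hT.one_le 0 c).2
      omega
  refine mem_dyckPaths_of_count_le cN ?_ ?_
  · have h1 := count_N_add_count_E (wordOf T ((k + 1) * n))
    have h2 : (wordOf T ((k + 1) * n)).length = (k + 1) * n := by simp [wordOf]
    rw [h2, cN] at h1
    have : (k + 1) * n = k * n + n := Nat.succ_mul k n
    omega
  · intro u v huv
    have hlen : u.length ≤ (k + 1) * n := by
      have := congrArg List.length huv
      simp [wordOf] at this
      omega
    have hu : u = wordOf T u.length := by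
      rw [← take_wordOf T hlen, huv, take_left]
    rw [hu]
    exact hT.count_E_wordOf_le (by simpa [wordOf] using hlen)

/-! ### Recovering the cut, and bijectivity of the sweep map -/

lemma countP_lt_countP {α : Type*} {p q : α → Bool} {l : List α} (h : ∀ x ∈ l, p x → q x) {a : α}
    (ha : a ∈ l) (hp : ¬ p a) (hq : q a) : l.countP p < l.countP q := by
  induction l with
  | nil => simp at ha
  | cons x l ih =>
    have h' : ∀ x ∈ l, p x → q x := fun y hy => h y (by simp [hy])
    rw [countP_cons, countP_cons]
    rcases mem_cons.1 ha with rfl | ha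
    · have := countP_mono_left h'
      rw [if_neg hp, if_pos hq]
      omega
    · have := ih h' ha
      have hx := h x (by simp)
      by_cases hpx : p x
      · rw [if_pos hpx, if_pos (hx hpx)]; omega
      · rw [if_neg hpx]; omega

/-- The number of nodes of smaller rank determines the rank of the cut, and distinct nodes have
distinct ranks. Nonempty `B₁`, `B₂` ensure that the cuts are listed nodes. -/
lemma eq_of_countP_eq {A₁ A₂ B₁ B₂ : List Step} (h : A₁ ++ B₁ ∈ dyckPaths (k * n + 1) n)
    (heq : A₁ ++ B₁ = A₂ ++ B₂) (h₁ : B₁ ≠ []) (h₂ : B₂ ≠ [])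
    (hc : ((positions (A₁ ++ B₁)).countP fun p =>
        decide (ht (k * n + 1) n p.1 < ht (k * n + 1) n A₁)) =
      (positions (A₁ ++ B₁)).countP fun p =>
        decide (ht (k * n + 1) n p.1 < ht (k * n + 1) n A₂)) : A₁ = A₂ := by
  have key : ∀ A B C : List Step, A ++ B = A₁ ++ B₁ → B ≠ [] →
      ht (k * n + 1) n A < ht (k * n + 1) n C →
      ((positions (A₁ ++ B₁)).countP fun p =>
        decide (ht (k * n + 1) n p.1 < ht (k * n + 1) n A)) <
      (positions (A₁ ++ B₁)).countP fun p =>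
        decide (ht (k * n + 1) n p.1 < ht (k * n + 1) n C) := by
    intro A B C hAB hB hlt
    obtain ⟨s, B, rfl⟩ := exists_cons_of_ne_nil hB
    refine countP_lt_countP ?_ (mem_positions.2 ⟨B, hAB.symm⟩ : (A, s) ∈ positions (A₁ ++ B₁)) ?_ ?_
    · intro x _ hx
      simp only [decide_eq_true_eq] at hx ⊢
      omega
    · simp
    · simpa using hlt
  have hht : ht (k * n + 1) n A₁ = ht (k * n + 1) n A₂ := by
    rcases lt_trichotomy (ht (k * n + 1) n A₁) (ht (k * n + 1) n A₂) with h3 | h3 | h3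
    · exact absurd hc (key A₁ B₁ A₂ rfl h₁ h3).ne
    · exact h3
    · exact absurd hc (key A₂ B₂ A₁ heq.symm h₂ h3).ne'
  have key2 : ∀ A B C D : List Step, A ++ B = A₁ ++ B₁ → B = C ++ D → D ≠ [] →
      ht (k * n + 1) n (A ++ C) = ht (k * n + 1) n A → C = [] := by
    rintro A _ C D hAB rfl hD hh
    by_contra hC
    rw [← append_assoc] at hAB
    refine ht_ne_zero_of_factor h.1 h.2.1 hAB.symm hC (by simp [hD]) ?_
    rw [ht_append] at hh
    omega
  rcases append_eq_append_iff.1 heq with ⟨C, rfl, hC⟩ | ⟨C, rfl, hC⟩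
  · rw [key2 A₁ B₁ C B₂ rfl hC h₂ hht.symm, append_nil]
  · rw [key2 A₂ B₂ C B₁ heq.symm hC h₁ hht, append_nil]

lemma tableau_sweep_cons_swap_append {A B : List Step} (h : A ++ B ∈ dyckPaths (k * n + 1) n)
    (hA : ht (k * n + 1) n A ≤ k * n) :
    red (tableau k (n + 1) (sweep (k * (n + 1) + 1) (n + 1)
      (Step.N :: (B ++ A ++ replicate k Step.E)))) =
      tableau k n (sweep (k * n + 1) n (A ++ B)) ∧
    tableau k (n + 1) (sweep (k * (n + 1) + 1) (n + 1)
      (Step.N :: (B ++ A ++ replicate k Step.E))) (Fin.last k) 0 =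
      k + 1 + (positions (A ++ B)).countP
        fun p => decide (ht (k * n + 1) n p.1 < ht (k * n + 1) n A) := by
  have hP := cons_swap_append_mem h hA
  obtain ⟨L', hL'⟩ := exists_isSortedNodes h
  obtain ⟨L, hL⟩ := exists_isSortedNodes hP
  have hR : IsRankSystem k (n + 1) L := hL.isRankSystem (Nat.succ_pos n) hP
  obtain ⟨h1, h2⟩ := cut_swap_nodes h hL' hL
  rw [hL.sweep_eq, hL'.sweep_eq, hR.red_tableau, h1]
  exact ⟨rfl, (hR.tableau_zero (Fin.last k)).trans h2⟩

lemma sweep_perm (m n : ℕ) (w : List Step) : (sweep m n w).Perm w := by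
  rw [sweep]
  refine ((mergeSort_perm _ _).map _).trans (Perm.of_eq ?_)
  exact zipIdx_map_fst 0 w

/-- Split a prefix into surviving letters `X` and deleted letters `Y`. The bound `#E ≤ k·#N` holds
for `X` because the surviving word is a Dyck path, and for `Y` because it has at most `k + 1`
letters, one of them the North step of rank `0`. -/
lemma sweep_cons_swap_append_mem {A B : List Step} (h : A ++ B ∈ dyckPaths (k * n + 1) n)
    (hA : ht (k * n + 1) n A ≤ k * n)
    (hs : sweep (k * n + 1) n (A ++ B) ∈ dyckPaths (k * n + 1) n) :
    sweep (k * (n + 1) + 1) (n + 1) (Step.N :: (B ++ A ++ replicate k Step.E)) ∈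
      dyckPaths (k * (n + 1) + 1) (n + 1) := by
  have hP := cons_swap_append_mem h hA
  obtain ⟨L', hL'⟩ := exists_isSortedNodes h
  obtain ⟨L, hL⟩ := exists_isSortedNodes hP
  have hR : IsRankSystem k (n + 1) L := hL.isRankSystem (Nat.succ_pos n) hP
  obtain ⟨h1, -⟩ := cut_swap_nodes h hL' hL
  have hp := sweep_perm (k * (n + 1) + 1) (n + 1) (Step.N :: (B ++ A ++ replicate k Step.E))
  rw [hL.sweep_eq] at hp ⊢
  rw [hL'.sweep_eq, ← h1] at hs
  obtain ⟨Q, l, rfl, hl⟩ := hR.exists_last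
  have hsQ := hL.sorted.sublist (sublist_append_left Q [l])
  obtain ⟨hZ, -⟩ := hR.fillLabeled_eq hl
  rw [filter_append, filter_cons_of_pos (by simp only [decide_eq_true_eq]; omega), filter_nil,
    map_append, map_singleton] at hs
  -- The letter of largest rank survives the deletion, so it is the last letter of a Dyck path.
  have hlE : l.2 = Step.E := by
    obtain ⟨u, hu⟩ := dyck_eq_append_E (Nat.succ_pos _) hs
    have := (append_inj' hu rfl).2
    simpa using this
  rw [map_append, map_singleton, hlE] at hp ⊢
  rw [hlE] at hs
  have cN := hp.count_eq Step.N
  have cE := hp.count_eq Step.E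
  rw [hP.1, count_append] at cN
  rw [hP.2.1, count_append] at cE
  refine mem_dyckPaths_of_count_le (by simpa using cN) (by simpa using cE) ?_
  intro u v huv
  obtain ⟨pre, suf, rfl, rfl, rfl⟩ := map_eq_append_iff.1 huv
  rcases eq_or_ne pre [] with rfl | hne
  · simp
  have hsplit : ∀ s : Step, (pre.map Prod.snd).count s =
      ((pre.filter fun p => decide (¬ ((n + 1) ∣ p.1 ∧ p.1 ≤ k * (n + 1)))).map
        Prod.snd).count s +
      ((pre.filter fun p => decide ((n + 1) ∣ p.1 ∧ p.1 ≤ k * (n + 1))).map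
        Prod.snd).count s := by
    intro s
    rw [count_eq_countP, countP_map, count_eq_countP, countP_map, count_eq_countP, countP_map,
      countP_eq_countP_filter_add _ _ (fun p : ℕ × Step => decide ((n + 1) ∣ p.1 ∧ p.1 ≤ k * (n + 1))), add_comm]
    congr 2
    refine filter_congr fun p _ => ?_
    rw [decide_not]
  rw [hsplit, hsplit]
  set X := (pre.filter fun p => decide (¬ ((n + 1) ∣ p.1 ∧ p.1 ≤ k * (n + 1)))).map Prod.snd
    with hX
  set Y := (pre.filter fun p => decide ((n + 1) ∣ p.1 ∧ p.1 ≤ k * (n + 1))).map Prod.snd with hY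
  have hXle : X.count Step.E ≤ k * X.count Step.N := by
    rw [filter_append, map_append, append_assoc, ← hX] at hs
    have h3 := (mem_dyckPaths_iff.1 hs).2.2 X _ rfl
    have h4 := hs.1
    have h5 := hs.2.1
    rw [count_append, count_append] at h4 h5
    have e1 : [Step.E].count Step.E = 1 := rfl
    rw [ht_eq] at h3
    by_contra hcon
    -- If `k·#N - #E < 0`, nonnegative rank forces `#N = n`; but the final East step lies outside
    -- `X`, so `#E ≤ kn`.
    have h6 : X.count Step.N ≤ n := by omega
    have h7 : X.count Step.E ≤ k * n := by omega
    have h8 : (k * X.count Step.N : ℤ) - X.count Step.E ≤ -1 := by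
      zify at hcon; omega
    have h9 : (n : ℤ) * (k * X.count Step.N - X.count Step.E : ℤ) ≤ n * (-1) := by gcongr
    have h10 : X.count Step.N = n := by zify at h6 ⊢; omega
    rw [h10] at hcon
    exact hcon h7
  have hYlen : Y.length ≤ k + 1 := by
    rw [hY, length_map]
    have h3 := congrArg List.length hZ
    rw [map_append, filter_append, length_append, length_map, length_range, filter_map,
      length_map] at h3
    have h4 : (pre.filter ((fun r => decide ((n + 1) ∣ r ∧ r ≤ k * (n + 1))) ∘ Prod.fst)).length =
      (pre.filter fun p => decide ((n + 1) ∣ p.1 ∧ p.1 ≤ k * (n + 1))).length := rfl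
    omega
  have hYN : 0 < Y.count Step.N := by
    rw [count_pos_iff]
    obtain ⟨p, pre', rfl⟩ := exists_cons_of_ne_nil hne
    obtain rfl : p = (0, Step.N) := hR.eq_zero_of_prefix (by simp)
    simp [hY]
  have hYc := count_N_add_count_E Y
  have h3 : k * 1 ≤ k * Y.count Step.N := Nat.mul_le_mul_left k hYN
  rw [Nat.mul_add]
  omega

/-- The sweep map is injective on the paths `N B A E ⋯ E` if it is injective on the paths `A B`. -/
lemma eq_of_sweep_eq {A₁ A₂ B₁ B₂ : List Step}
    (hbij : Set.BijOn (sweep (k * n + 1) n) (dyckPaths (k * n + 1) n) (dyckPaths (k * n + 1) n))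
    (h₁ : A₁ ++ B₁ ∈ dyckPaths (k * n + 1) n) (h₂ : A₂ ++ B₂ ∈ dyckPaths (k * n + 1) n)
    (hA₁ : ht (k * n + 1) n A₁ ≤ k * n) (hA₂ : ht (k * n + 1) n A₂ ≤ k * n)
    (hB₁ : B₁ ≠ []) (hB₂ : B₂ ≠ [])
    (h : sweep (k * (n + 1) + 1) (n + 1) (Step.N :: (B₁ ++ A₁ ++ replicate k Step.E)) =
      sweep (k * (n + 1) + 1) (n + 1) (Step.N :: (B₂ ++ A₂ ++ replicate k Step.E))) :
    A₁ = A₂ ∧ B₁ = B₂ := by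
  obtain ⟨r₁, t₁⟩ := tableau_sweep_cons_swap_append h₁ hA₁
  obtain ⟨r₂, t₂⟩ := tableau_sweep_cons_swap_append h₂ hA₂
  rw [h] at r₁ t₁
  have heq : A₁ ++ B₁ = A₂ ++ B₂ := hbij.injOn h₁ h₂
    (tableau_injOn k n (hbij.mapsTo h₁) (hbij.mapsTo h₂) (r₁.symm.trans r₂))
  rw [t₁, ← heq] at t₂
  have hA := eq_of_countP_eq h₁ heq hB₁ hB₂ (by omega)
  refine ⟨hA, ?_⟩
  rw [hA] at heq
  exact append_cancel_left heq

lemma eq_singleton_of_mem_dyckPaths_zero {w : List Step} (hw : w ∈ dyckPaths (k * 0 + 1) 0) :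
    w = [Step.E] := by
  obtain ⟨u, rfl⟩ := dyck_eq_append_E (Nat.succ_pos _) hw
  have := length_dyck hw
  rw [length_append] at this
  simp at this
  simp [this]

/-- The sweep map is a bijection on the paths from `(0, 0)` to `(k * n + 1, n)`. -/
theorem sweep_bijOn (k n : ℕ) :
    Set.BijOn (sweep (k * n + 1) n) (dyckPaths (k * n + 1) n) (dyckPaths (k * n + 1) n) := by
  induction n with
  | zero =>
    refine ((finite_dyckPaths _ _).injOn_iff_bijOn_of_mapsTo ?_).1 ?_
    · intro w hw
      have h := eq_singleton_of_mem_dyckPaths_zero hw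
      rw [h] at hw ⊢
      rwa [perm_singleton.1 (sweep_perm (k * 0 + 1) 0 [Step.E])]
    · intro w hw w' hw' _
      rw [eq_singleton_of_mem_dyckPaths_zero hw, eq_singleton_of_mem_dyckPaths_zero hw']
  | succ n ih =>
    -- On a finite set an injective self-map is bijective, so no inverse of the sweep map is
    -- constructed.
    refine ((finite_dyckPaths _ _).injOn_iff_bijOn_of_mapsTo ?_).1 ?_
    · intro P hP
      obtain ⟨A, B, -, h, hA, rfl⟩ := exists_cons_swap_append hP
      exact sweep_cons_swap_append_mem h hA (ih.mapsTo h)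
    · intro P₁ hP₁ P₂ hP₂ heq
      obtain ⟨A₁, B₁, hB₁, h₁, hA₁, rfl⟩ := exists_cons_swap_append hP₁
      obtain ⟨A₂, B₂, hB₂, h₂, hA₂, rfl⟩ := exists_cons_swap_append hP₂
      obtain ⟨rfl, rfl⟩ := eq_of_sweep_eq ih h₁ h₂ hA₁ hA₂ hB₁ hB₂ heq
      rfl

/-! ### Circled nodes and the paths with given reduction -/

/-- The bottom entry is the position of rank `kn` in the sorted list, that is, the number of nodes
of rank at most `kn`. -/
lemma ncard_circled {P : List Step} (hn : 0 < n) (hP : P ∈ dyckPaths (k * n + 1) n) :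
    (circled (k * n + 1) n P).ncard =
      tableau k n (sweep (k * n + 1) n P) (Fin.last k) ⟨0, hn⟩ := by
  obtain ⟨L, hL⟩ := exists_isSortedNodes hP
  rw [hL.sweep_eq, (hL.isRankSystem hn hP).tableau_zero, Fin.val_last]
  have h1 := hL.perm.countP_eq (fun p => decide (p.1 ≤ ((k * n : ℕ) : ℤ)))
  rw [countP_map, countP_map] at h1
  have h2 : pos L (k * n) = countP ((fun p : ℤ × Step => decide (p.1 ≤ ((k * n : ℕ) : ℤ))) ∘
      fun p : ℕ × Step => ((p.1 : ℤ), p.2)) L := by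
    refine countP_congr fun p _ => ?_
    simp only [Function.comp_apply, Nat.cast_le]
  have h3 : (positions P).map Prod.fst = (range P.length).map P.take := by
    apply List.ext_getElem
    · simp [length_positions]
    · intro i _ _
      simp [positions]
  have h4 : circled (k * n + 1) n P =
      ((Finset.range P.length).filter fun i => ht (k * n + 1) n (P.take i) ≤ ((k * n : ℕ) : ℤ) :
        Finset ℕ) := by
    ext i
    simp only [circled, Set.mem_ofPred_eq, rank_eq_ht, Finset.coe_filter, Finset.mem_range]
    push_cast
    rw [Int.lt_add_one_iff]
  have h5 : countP ((fun p : ℤ × Step => decide (p.1 ≤ ((k * n : ℕ) : ℤ))) ∘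
      fun p : List Step × Step => (ht (k * n + 1) n p.1, p.2)) (positions P) =
      countP (fun u => decide (ht (k * n + 1) n u ≤ ((k * n : ℕ) : ℤ)))
        ((positions P).map Prod.fst) := by
    rw [countP_map]; rfl
  rw [h2, h1, h5, h3, countP_map, h4, Set.ncard_coe_finset, countP_eq_length_filter]
  rfl

lemma of_mem_circled {P : List Step} {i : ℕ} (hi : i ∈ circled (k * n + 1) n P) :
    ht (k * n + 1) n (P.take i) ≤ k * n ∧ P.drop i ≠ [] := by
  obtain ⟨h1, h2⟩ := hi
  rw [rank_eq_ht] at h2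
  push_cast at h2
  refine ⟨by omega, by simpa using h1⟩

/-- For surjectivity, write `D` as the sweep of some `N B A E^k`; the reduced tableau determines
`AB`, because both `T` and the sweep map are injective, so `AB = P`. -/
lemma bijOn_circled {P : List Step} (hP : P ∈ dyckPaths (k * n + 1) n) :
    Set.BijOn (fun i => sweep (k * (n + 1) + 1) (n + 1) (cutSwap k P i))
      (circled (k * n + 1) n P)
      {D | D ∈ dyckPaths (k * (n + 1) + 1) (n + 1) ∧
        red (tableau k (n + 1) D) = tableau k n (sweep (k * n + 1) n P)} := by
  have hsplit : ∀ i, P.take i ++ P.drop i = P := fun i => take_append_drop i P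
  refine ⟨?_, ?_, ?_⟩
  · intro i hi
    obtain ⟨hA, -⟩ := of_mem_circled hi
    have h : P.take i ++ P.drop i ∈ dyckPaths (k * n + 1) n := by rwa [hsplit]
    refine ⟨(sweep_bijOn k (n + 1)).mapsTo (cons_swap_append_mem h hA), ?_⟩
    have := (tableau_sweep_cons_swap_append h hA).1
    rwa [hsplit] at this
  · intro i hi j hj hij
    obtain ⟨hA, hB⟩ := of_mem_circled hi
    obtain ⟨hA', hB'⟩ := of_mem_circled hj
    have h := (eq_of_sweep_eq (sweep_bijOn k n) (by rwa [hsplit]) (by rwa [hsplit])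
      hA hA' hB hB' hij).1
    have := congrArg List.length h
    rw [length_take, length_take] at this
    have := hi.1
    have := hj.1
    omega
  · rintro D ⟨hD, hred⟩
    obtain ⟨Q, hQ, rfl⟩ := (sweep_bijOn k (n + 1)).surjOn hD
    obtain ⟨A, B, hB, h, hA, rfl⟩ := exists_cons_swap_append hQ
    rw [(tableau_sweep_cons_swap_append h hA).1] at hred
    have hAB : A ++ B = P := (sweep_bijOn k n).injOn h hP (tableau_injOn k n
      ((sweep_bijOn k n).mapsTo h) ((sweep_bijOn k n).mapsTo hP) hred)
    refine ⟨A.length, ⟨?_, ?_⟩, ?_⟩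
    · have := length_pos_iff.2 hB
      rw [← hAB, length_append]
      omega
    · rw [rank_eq_ht, ← hAB, take_left]
      push_cast
      omega
    · simp only [cutSwap, ← hAB, take_left, drop_left]

end FussDyck

theorem mainTheorem4 (k n' : ℕ) (hn' : 0 < n') (T' : Matrix (Fin (k + 1)) (Fin n') ℕ)
    (hT' : FussDyck.IsFussTableau k n' T') :
    {D | D ∈ FussDyck.dyckPaths (k * (n' + 1) + 1) (n' + 1) ∧
        FussDyck.red (FussDyck.tableau k (n' + 1) D) = T'}.ncard = T' (Fin.last k) ⟨0, hn'⟩ ∧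
    (∃! D', D' ∈ FussDyck.dyckPaths (k * n' + 1) n' ∧ FussDyck.tableau k n' D' = T') ∧
    ∀ D', D' ∈ FussDyck.dyckPaths (k * n' + 1) n' → FussDyck.tableau k n' D' = T' →
      (∃! P', P' ∈ FussDyck.dyckPaths (k * n' + 1) n' ∧
        FussDyck.sweep (k * n' + 1) n' P' = D') ∧
      ∀ P', P' ∈ FussDyck.dyckPaths (k * n' + 1) n' →
        FussDyck.sweep (k * n' + 1) n' P' = D' →
        (∀ i ∈ FussDyck.circled (k * n' + 1) n' P',
          FussDyck.cutSwap k P' i ∈ FussDyck.dyckPaths (k * (n' + 1) + 1) (n' + 1)) ∧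
        Set.BijOn
          (fun i => FussDyck.sweep (k * (n' + 1) + 1) (n' + 1) (FussDyck.cutSwap k P' i))
          (FussDyck.circled (k * n' + 1) n' P')
          {D | D ∈ FussDyck.dyckPaths (k * (n' + 1) + 1) (n' + 1) ∧
            FussDyck.red (FussDyck.tableau k (n' + 1) D) = T'} := by

  have hsw := FussDyck.sweep_bijOn k n'
  have hex := hT'.exists_dyckPath
  have huniq : ∀ D, D ∈ FussDyck.dyckPaths (k * n' + 1) n' → ∀ D₀,
      D₀ ∈ FussDyck.dyckPaths (k * n' + 1) n' → FussDyck.tableau k n' D = T' →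
      FussDyck.tableau k n' D₀ = T' → D = D₀ := fun D hD D₀ hD₀ h h₀ =>
    FussDyck.tableau_injOn k n' hD hD₀ (h.trans h₀.symm)
  refine ⟨?_, ?_, ?_⟩
  · obtain ⟨D', hD', hT⟩ := hex
    obtain ⟨P', hP', rfl⟩ := hsw.surjOn hD'
    have hb := FussDyck.bijOn_circled hP'
    rw [hT] at hb
    rw [← hb.ncard_eq, FussDyck.ncard_circled hn' hP', hT]
  · obtain ⟨D', hD', hT⟩ := hex
    exact ⟨D', ⟨hD', hT⟩, fun D hD => huniq D hD.1 D' hD' hD.2 hT⟩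
  · intro D' hD' hT
    obtain ⟨P₀, hP₀, h₀⟩ := hsw.surjOn hD'
    refine ⟨⟨P₀, ⟨hP₀, h₀⟩, fun P hP => hsw.injOn hP.1 hP₀ (hP.2.trans h₀.symm)⟩, ?_⟩
    rintro P' hP' rfl
    refine ⟨fun i hi => ?_, ?_⟩
    · refine FussDyck.cons_swap_append_mem ?_ (FussDyck.of_mem_circled hi).1
      rwa [List.take_append_drop]
    · have hb := FussDyck.bijOn_circled hP'
      rwa [hT] at hb
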